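/- **Setting (contextual linear bandit).** Fix $d,T\in\mathbb N$ and $\theta^*\in\mathbb R^d$ with $\|\theta^*\|_2\le 1$. In round $t=1,\dots,T$ a decision set $\mathcal X_t\subseteq\{x\in\mathbb R^d:\|x\|_2\le 1\}$ is revealed (it may be random and may depend on the past), the algorithm plays $x_t\in\mathcal X_t$, and the reward is $y_t=\langle x_t,\theta^*\rangle+\eta_t$, where $\eta_t\in[-1,1]$ has conditional mean $0$ given everything that happened before the reward of round $t$. With $x_{t,*}\in\arg\max_{x\in\mathcal X_t}\langle x,\theta^*\rangle$ (all maxima are assumed attained), the regret is $\mathrm{Reg}_T=\sum_{t=1}^T\langle x_{t,*},\theta^*\rangle-\langle x_t,\theta^*\rangle$. **Algorithm (LDP LinUCB).** Given privacy parameters $\varepsilon,\delta$, failure probability $\alpha$, and a factor $\kappa\ge 1$, put $\sigma=6\sqrt{2\ln(2.5/\delta)}/\varepsilon$ and $$\Upsilon_t=\sigma\sqrt t\,\bigl(4\sqrt d+2\ln(2T/\alpha)\bigr),\quad c_t=2\Upsilon_t,\quad \beta_t=2\sigma\sqrt{d\ln T}+\Bigl(\sqrt{3\Upsilon_t}+\sigma\sqrt{dt/\Upsilon_t}\Bigr)\kappa\ln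 T .$$ Start from $\tilde V_0=0$, $\tilde u_0=0$, $\tilde\theta_0=0$. In round $t$ the user plays $$x_t\in\arg\max_{x\in\mathcal X_t}\ \langle\tilde\theta_{t-1},x\rangle+\beta_t\|x\|_{(\tilde V_{t-1}+c_{t-1}I)^{-1}},\qquad \|x\|_M=\sqrt{x^\top Mx},$$ (in the first round any $x_1\in\mathcal X_1$ is allowed; ties are broken in any non-anticipating way) and sends $x_tx_t^\top+B_t$ and $y_tx_t+\xi_t$. Here $B_t$ is a symmetric matrix whose entries on and above the diagonal are i.i.d. $\mathcal N(0,\sigma^2)$, $\xi_t\sim\mathcal N(0,\sigma^2I_d)$, and $B_t,\xi_t$ are independent of each other, of the past and of $\eta_t$. The server sets $\tilde V_t=\tilde V_{t-1}+x_tx_t^\top+B_t$, $\tilde u_t=\tilde u_{t-1}+y_tx_t+\xi_t$, $\tilde\theta_t=(\tilde V_t+c_tI)^{-1}\tilde u_t$. **Theorem.** For all real $\varepsilon_0$ and $p<1$ there are $C\in\mathbb R$ and $k\in\mathbb N$, depending only on $\varepsilon_0$ and $p$, such that for all $d,T$, all $\varepsilon\in(0,\varepsilon_0]$, $\delta,\alpha\in(0,p]$,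 $\kappa\ge 1$, and every bandit instance as above, with probability at least $1-\alpha$, $$\mathrm{Reg}_T\ \le\ C\,\kappa\,(1+\ln T)^k\,\sqrt{\log\tfrac1\delta\,\log\tfrac1\alpha}\;\frac{(dT)^{3/4}}{\varepsilon}.$$ In particular, for $\kappa=1$ the regret is $\tilde O\bigl(\sqrt{\log(1/\delta)\log(1/\alpha)}\,(dT)^{3/4}/\varepsilon\bigr)$ uniformly in $d$. For $\kappa=d\ge 1$ (the radius $\beta_t$ as originally printed) the same bound holds with the extra factor $d$, so it is $\tilde O\bigl(\sqrt{\log(1/\delta)\log(1/\alpha)}\,(dT)^{3/4}/\varepsilon\bigr)$ when $\tilde O$ hides factors in the dimension as well as poly-logarithmic ones. -/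

import Mathlib

open MeasureTheory ProbabilityTheory
open scoped Matrix

noncomputable section

namespace LDPLinUCB

/-- The parameters of the algorithm: dimension `d`, horizon `T`, privacy parameters `ε`, `δ`,
failure probability `α`, and the factor `κ` in the confidence radius `beta` below. -/
structure Params where
  d : ℕ
  T : ℕ
  ε : ℝ
  δ : ℝ
  α : ℝ
  κ : ℝ

/-- The space of actions and parameters, with the Euclidean norm. -/
abbrev Vec (P : Params) : Type := EuclideanSpace ℝ (Fin P.d)

/-- Standard deviation of the privacy noise: `σ = 6 √(2 ln (2.5 / δ)) / ε`. -/
def sigma (P : Params) : ℝ := 6 * √(2 * Real.log (2.5 / P.δ)) / P.ε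

/-- `Υ_t = σ √t (4 √d + 2 ln (2T / α))`. -/
def upsilon (P : Params) (t : ℕ) : ℝ :=
  sigma P * √t * (4 * √P.d + 2 * Real.log (2 * P.T / P.α))

/-- The regularization `c_t = 2 Υ_t`. -/
def shift (P : Params) (t : ℕ) : ℝ := 2 * upsilon P t

/-- The confidence radius
`β_t = 2 σ √(d ln T) + (√(3 Υ_t) + σ √(d t / Υ_t)) κ ln T`. -/
def beta (P : Params) (t : ℕ) : ℝ :=
  2 * sigma P * √(P.d * Real.log P.T) +
    (√(3 * upsilon P t) + sigma P * √(P.d * t / upsilon P t)) * (P.κ * Real.log P.T)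

/-- Index set of the scalar noises drawn by one user: the entries `(i, j)`, `i ≤ j`, of the noise
matrix, and the coordinates of the noise vector. -/
abbrev NoiseIdx (P : Params) : Type :=
  {q : Fin P.d × Fin P.d // q.1 ≤ q.2} ⊕ Fin P.d

/-- The symmetric noise matrix `B` with the given entries on and above the diagonal. -/
def noiseMatrix (P : Params) (z : NoiseIdx P → ℝ) : Matrix (Fin P.d) (Fin P.d) ℝ :=
  Matrix.of fun i j => z (Sum.inl ⟨(min i j, max i j), min_le_max⟩)

/-- The noise vector `ξ`. -/
def noiseVector (P : Params) (z : NoiseIdx P → ℝ) : Fin P.d → ℝ :=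
  fun i => z (Sum.inr i)

/-- The law of the scalar noises of one user: independent, each `N(0, σ²)`. -/
def noiseLaw (P : Params) : Measure (NoiseIdx P → ℝ) :=
  Measure.pi fun _ => gaussianReal 0 (Real.toNNReal (sigma P ^ 2))

/-! Users are numbered from `0`, so user `t` below is the `(t+1)`-st user. A realization consists
of the sequences of actions `x`, reward noises `η` and privacy noises `z`. -/

/-- The reward `y = ⟨x, θ⟩ + η` of user `t`. -/
def reward (P : Params) (θ : Vec P) (x : ℕ → Vec P) (η : ℕ → ℝ) (t : ℕ) : ℝ :=
  inner ℝ (x t) θ + η t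

/-- The server's matrix after `t` users: the sum of the received `x xᵀ + B`. -/
def serverMatrix (P : Params) (x : ℕ → Vec P) (z : ℕ → NoiseIdx P → ℝ) (t : ℕ) :
    Matrix (Fin P.d) (Fin P.d) ℝ :=
  ∑ s ∈ Finset.range t, (Matrix.vecMulVec (x s).ofLp (x s).ofLp + noiseMatrix P (z s))

/-- The server's vector after `t` users: the sum of the received `y x + ξ`. -/
def serverVector (P : Params) (θ : Vec P) (x : ℕ → Vec P) (η : ℕ → ℝ)
    (z : ℕ → NoiseIdx P → ℝ) (t : ℕ) : Fin P.d → ℝ :=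
  ∑ s ∈ Finset.range t, (reward P θ x η s • (x s).ofLp + noiseVector P (z s))

/-- The inverse `(V_t + c_t I)⁻¹` of the regularized matrix after `t` users. For `t = 0` the
matrix is zero and the convention `0⁻¹ = 0` makes every action of the first user admissible. -/
def regInv (P : Params) (x : ℕ → Vec P) (z : ℕ → NoiseIdx P → ℝ) (t : ℕ) :
    Matrix (Fin P.d) (Fin P.d) ℝ :=
  (serverMatrix P x z t + shift P t • (1 : Matrix (Fin P.d) (Fin P.d) ℝ))⁻¹

/-- The estimator `(V_t + c_t I)⁻¹ u_t` after `t` users. -/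
def estimator (P : Params) (θ : Vec P) (x : ℕ → Vec P) (η : ℕ → ℝ)
    (z : ℕ → NoiseIdx P → ℝ) (t : ℕ) : Vec P :=
  WithLp.toLp 2 (regInv P x z t *ᵥ serverVector P θ x η z t)

/-- `‖v‖_M = √(vᵀ M v)`. -/
def matNorm (P : Params) (M : Matrix (Fin P.d) (Fin P.d) ℝ) (v : Vec P) : ℝ :=
  √(v.ofLp ⬝ᵥ (M *ᵥ v.ofLp))

/-- The optimistic index that user `t` (the `(t+1)`-st user) maximizes over the available
actions. -/
def ucb (P : Params) (θ : Vec P) (x : ℕ → Vec P) (η : ℕ → ℝ)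
    (z : ℕ → NoiseIdx P → ℝ) (t : ℕ) (v : Vec P) : ℝ :=
  inner ℝ (estimator P θ x η z t) v + beta P (t + 1) * matNorm P (regInv P x z t) v

/-- The regret `∑ ⟨x_*, θ⟩ - ⟨x, θ⟩` over `T` rounds. -/
def regret (P : Params) (θ : Vec P) (x xs : ℕ → Vec P) : ℝ :=
  ∑ t ∈ Finset.range P.T, (inner ℝ (xs t) θ - inner ℝ (x t) θ)

/-- The algorithm, run for `T` rounds on a linear bandit with parameter `θ`. The decision sets
`D t` may be random and may depend on the past in any way; `𝓕 t` is the information available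
just before user `t` acts (including the decision set of user `t`). -/
structure IsRun (P : Params) {Ω : Type*} [mΩ : MeasurableSpace Ω] (μ : Measure Ω)
    (𝓕 : Filtration ℕ mΩ) (θ : Vec P) (D : ℕ → Ω → Set (Vec P)) (x xs : ℕ → Ω → Vec P)
    (η : ℕ → Ω → ℝ) (z : ℕ → Ω → NoiseIdx P → ℝ) : Prop where
  /-- The unknown parameter and the available actions lie in the unit ball. -/
  norm_param : ‖θ‖ ≤ 1
  norm_action : ∀ t < P.T, ∀ ω, ∀ v ∈ D t ω, ‖v‖ ≤ 1
  /-- `xs t` is an optimal action for user `t`. -/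
  best_mem : ∀ t < P.T, ∀ ω, xs t ω ∈ D t ω
  best_max : ∀ t < P.T, ∀ ω, IsMaxOn (fun v => inner ℝ v θ) (D t ω) (xs t ω)
  /-- `x t` is the action that the algorithm plays, ties being broken in any non-anticipating
  way. -/
  action_meas : ∀ t < P.T, Measurable[𝓕 t] (x t)
  action_mem : ∀ t < P.T, ∀ ω, x t ω ∈ D t ω
  action_max : ∀ t < P.T, ∀ ω,
    IsMaxOn (ucb P θ (fun s => x s ω) (fun s => η s ω) (fun s => z s ω) t) (D t ω) (x t ω)
  /-- The reward noise takes values in `[-1, 1]` and has conditional mean zero. -/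
  noise_meas : ∀ t < P.T, Measurable[𝓕 (t + 1)] (η t)
  noise_bdd : ∀ t < P.T, ∀ᵐ ω ∂μ, |η t ω| ≤ 1
  noise_mean : ∀ t < P.T, μ[η t | 𝓕 t] =ᵐ[μ] 0
  /-- The privacy noise of user `t` is Gaussian, and fresh: it is independent of the past and of
  the reward noise of user `t`. -/
  priv_meas : ∀ t < P.T, Measurable[𝓕 (t + 1)] (z t)
  priv_law : ∀ t < P.T, HasLaw (z t) (noiseLaw P) μ
  priv_indep : ∀ t < P.T,
    Indep (MeasurableSpace.comap (z t) inferInstance)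
      (𝓕 t ⊔ MeasurableSpace.comap (η t) inferInstance) μ

end LDPLinUCB

end

/-! Write H for the server's matrix after t users plus `c_t I`, and Υ for `Υ_t`. With probability at
least 1 - α, for every 1 ≤ t < T, the accumulated matrix noise (in operator norm) and vector noise
are at most (3/2)Υ, and the accumulated reward noise is at most (3/2)ε₀Υ. The shift 2Υ then
outweighs the matrix noise, so H dominates (Υ/2) I + ∑ x xᵀ.

The server's vector minus Hθ is reward noise plus vector noise minus matrix noise applied to θ minus
`c_t θ`, hence of size O(Υ). As H ≥ (Υ/2) I, its H⁻¹-norm is O(√Υ), and `β` covers this once ln T ≥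
5 + 2ε₀. Optimism bounds the regret of a round by 2β‖x‖ in the H⁻¹-norm, and the elliptical
potential lemma sums these to β√(dT) up to logarithms. Since Υ is at most about σ√(dT), β is at most
about σ(dT)^(1/4) when d ≤ T, and the product is σ(dT)^(3/4). In the remaining cases, T ≤ d or ln T
≤ 5 + 2ε₀, the trivial bound 2T suffices.

The noise bounds (`exists_bad_event`, `noise_le_of_net`) come from sub-Gaussian tails and a union
bound over a net of 5^d directions; this adds only O(d) to the exponent, hence the √d in Υ. The
deterministic part is `regret_le_of_noise`. Missing factors σ, ln(1/δ), ln(1/α) are supplied at the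
price of constants, because σε₀ ≥ 1 and both logarithms are at least ln(1/p) > 0. -/

namespace LDPLinUCB

/-! ### Nets of the sphere -/

/-- The unit sphere has a `1/2`-net with at most `5 ^ d` points. -/
theorem exists_sphere_net (d : ℕ) : ∃ s : Finset (EuclideanSpace ℝ (Fin d)), s.card ≤ 5 ^ d ∧
    (∀ v ∈ s, ‖v‖ = 1) ∧ ∀ u : EuclideanSpace ℝ (Fin d), ‖u‖ = 1 → ∃ v ∈ s, ‖u - v‖ ≤ 1 / 2 := by
  classical
  let good : Finset (EuclideanSpace ℝ (Fin d)) → Prop := fun s =>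
    (∀ v ∈ s, ‖v‖ = 1) ∧ ∀ u ∈ s, ∀ v ∈ s, u ≠ v → 1 / 2 ≤ ‖u - v‖
  have card_le : ∀ s, good s → s.card ≤ 5 ^ d := by
    intro s hs
    -- Doubling turns a 1/2-separated subset of the unit sphere into a 1-separated subset of the
    -- ball of radius 2, the normalization of the packing bound 5^d.
    have h := Besicovitch.card_le_of_separated
      (s.map ⟨fun v => (2 : ℝ) • v, smul_right_injective _ two_ne_zero⟩) ?_ ?_
    · simpa using h
    · intro c hc
      obtain ⟨v, hv, rfl⟩ := Finset.mem_map.1 hc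
      simp [norm_smul, hs.1 v hv]
    · intro c hc e he hce
      obtain ⟨u, hu, rfl⟩ := Finset.mem_map.1 hc
      obtain ⟨v, hv, rfl⟩ := Finset.mem_map.1 he
      have huv : u ≠ v := fun h => hce (by rw [h])
      have := hs.2 u hu v hv huv
      simp only [Function.Embedding.coeFn_mk, ← smul_sub, norm_smul, Real.norm_ofNat]
      linarith
  -- A separated set of maximal cardinality is a net: a point far from all of it could be added.
  let Q : ℕ → Prop := fun n => ∃ s, good s ∧ s.card = n
  have hQ0 : Q 0 := ⟨∅, ⟨by simp, by simp⟩, rfl⟩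
  obtain ⟨s, hs, hcard⟩ : Q (Nat.findGreatest Q (5 ^ d)) := Nat.findGreatest_spec (Nat.zero_le _) hQ0
  refine ⟨s, card_le s hs, hs.1, fun u hu => ?_⟩
  by_contra! hfar
  have hus : u ∉ s := fun h => by
    have := hfar u h
    norm_num at this
  have hgood : good (insert u s) := by
    refine ⟨?_, ?_⟩
    · intro v hv
      rcases Finset.mem_insert.1 hv with rfl | hv
      exacts [hu, hs.1 v hv]
    · intro a ha b hb hab
      rcases Finset.mem_insert.1 ha with h1 | h1 <;> rcases Finset.mem_insert.1 hb with h2 | h2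
      · exact absurd (h1.trans h2.symm) hab
      · rw [h1]; exact (hfar b h2).le
      · rw [h2, norm_sub_rev]; exact (hfar a h1).le
      · exact hs.2 a h1 b h2 hab
  have h1 := Nat.le_findGreatest (P := Q) (card_le _ hgood) ⟨_, hgood, rfl⟩
  rw [Finset.card_insert_of_notMem hus] at h1
  omega

/-- `s` is a `1/2`-net of the unit sphere. -/
def IsSphereNet {d : ℕ} (s : Finset (EuclideanSpace ℝ (Fin d))) : Prop :=
  (∀ v ∈ s, ‖v‖ = 1) ∧ ∀ u : EuclideanSpace ℝ (Fin d), ‖u‖ = 1 → ∃ v ∈ s, ‖u - v‖ ≤ 1 / 2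

/-- For u the direction of w and v a net point near u, ‖w‖ = ⟨v, w⟩ + ⟨u - v, w⟩ ≤ r + ‖w‖/2. -/
theorem IsSphereNet.norm_le {d : ℕ} {s : Finset (EuclideanSpace ℝ (Fin d))} (hs : IsSphereNet s)
    {w : EuclideanSpace ℝ (Fin d)} {r : ℝ} (hr : 0 ≤ r) (h : ∀ v ∈ s, inner ℝ v w ≤ r) :
    ‖w‖ ≤ 2 * r := by
  rcases eq_or_ne w 0 with rfl | hw
  · simpa using hr
  have hw' : 0 < ‖w‖ := norm_pos_iff.2 hw
  set u : EuclideanSpace ℝ (Fin d) := ‖w‖⁻¹ • w with hu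
  have hu1 : ‖u‖ = 1 := by rw [hu, norm_smul, norm_inv, norm_norm, inv_mul_cancel₀ hw'.ne']
  obtain ⟨v, hv, huv⟩ := hs.2 u hu1
  have h1 : inner ℝ u w = ‖w‖ := by
    rw [hu, real_inner_smul_left, real_inner_self_eq_norm_sq]
    field_simp
  have h2 : inner ℝ (u - v) w ≤ 1 / 2 * ‖w‖ :=
    (real_inner_le_norm _ _).trans (by gcongr)
  rw [inner_sub_left, h1] at h2
  linarith [h v hv]

theorem inner_eq_dotProduct {d : ℕ} (v w : EuclideanSpace ℝ (Fin d)) :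
    inner ℝ v w = v.ofLp ⬝ᵥ w.ofLp := by
  simp [EuclideanSpace.inner_eq_star_dotProduct, dotProduct_comm]

theorem dotProduct_mulVec_comm {n : Type*} [Fintype n] {A : Matrix n n ℝ} (hA : A.IsSymm)
    (v w : n → ℝ) : v ⬝ᵥ (A *ᵥ w) = w ⬝ᵥ (A *ᵥ v) := by
  rw [Matrix.dotProduct_mulVec, ← Matrix.mulVec_transpose, hA, dotProduct_comm]

/-- A symmetric matrix is bounded as an operator by its quadratic form on a net. -/
theorem IsSphereNet.norm_mulVec_le {d : ℕ} {s : Finset (EuclideanSpace ℝ (Fin d))}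
    (hs : IsSphereNet s) {A : Matrix (Fin d) (Fin d) ℝ} (hA : A.IsSymm) {r : ℝ} (hr : 0 ≤ r)
    (h : ∀ v ∈ s, |v.ofLp ⬝ᵥ (A *ᵥ v.ofLp)| ≤ r) (w : EuclideanSpace ℝ (Fin d)) :
    ‖WithLp.toLp 2 (A *ᵥ w.ofLp)‖ ≤ 2 * r * ‖w‖ := by
  rcases isEmpty_or_nonempty (Fin d) with hd | hd
  · have h0 : WithLp.toLp 2 (A *ᵥ w.ofLp) = 0 := by ext i; exact isEmptyElim i
    rw [h0, norm_zero]; positivity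
  have hH : A.IsHermitian := by rw [Matrix.IsHermitian, Matrix.conjTranspose_eq_transpose_of_trivial]; exact hA
  let b := hH.eigenvectorBasis
  let μ := hH.eigenvalues
  -- The usual perturbation estimate loses 2‖u - v‖‖A‖, which is too much for a 1/2-net. Comparing
  -- with an eigenvector of largest absolute eigenvalue removes the cross term, so the loss is
  -- quadratic in the distance.
  obtain ⟨i, hi⟩ := Finite.exists_max fun i => |μ i|
  have hcoord : ∀ (w : EuclideanSpace ℝ (Fin d)) j,
      inner ℝ (b j) (WithLp.toLp 2 (A *ᵥ w.ofLp)) = μ j * inner ℝ (b j) w := by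
    intro w j
    rw [inner_eq_dotProduct, inner_eq_dotProduct, dotProduct_mulVec_comm hA,
      hH.mulVec_eigenvectorBasis, dotProduct_smul, dotProduct_comm, smul_eq_mul]
  have hnorm : ∀ w : EuclideanSpace ℝ (Fin d),
      ‖WithLp.toLp 2 (A *ᵥ w.ofLp)‖ ≤ |μ i| * ‖w‖ := by
    intro w
    refine abs_le_of_sq_le_sq' ?_ (by positivity) |>.2
    rw [mul_pow, ← b.sum_sq_norm_inner_right, ← b.sum_sq_norm_inner_right w, Finset.mul_sum]
    refine Finset.sum_le_sum fun j _ => ?_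
    rw [hcoord, norm_mul, mul_pow]
    gcongr
    exact hi j
  have hb1 : ‖b i‖ = 1 := b.orthonormal.1 i
  obtain ⟨v, hv, hbv⟩ := hs.2 (b i) hb1
  have hv1 := hs.1 v hv
  have hAb : WithLp.toLp 2 (A *ᵥ (b i).ofLp) = μ i • b i := by
    ext j
    simp [b, μ, hH.mulVec_eigenvectorBasis]
  set a := inner ℝ (b i) v with ha
  set e := v - a • b i with he
  have hbb : inner ℝ (b i) (b i) = 1 := by rw [real_inner_self_eq_norm_sq, hb1]; norm_num
  have hbe : inner ℝ (b i) e = 0 := by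
    rw [he, inner_sub_right, real_inner_smul_right, hbb]; simp [ha]
  have hve : v = a • b i + e := by rw [he]; abel
  have hee : ‖e‖ ^ 2 = 1 - a ^ 2 := by
    rw [he, norm_sub_sq_real, hv1, real_inner_smul_right, real_inner_comm, norm_smul, hb1,
      Real.norm_eq_abs, mul_one, sq_abs, ← ha]
    ring
  -- 2 - 2a = ‖b i - v‖² ≤ 1/4.
  have hasq : 7 / 8 ≤ a := by
    have h1 : ‖b i - v‖ ^ 2 ≤ (1 / 2) ^ 2 := by gcongr
    rw [norm_sub_sq_real, hb1, hv1, ← ha] at h1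
    linarith
  have hquad : v.ofLp ⬝ᵥ (A *ᵥ v.ofLp)
      = a ^ 2 * μ i + inner ℝ e (WithLp.toLp 2 (A *ᵥ e.ofLp)) := by
    have h1 : WithLp.toLp 2 (A *ᵥ v.ofLp) = (a * μ i) • b i + WithLp.toLp 2 (A *ᵥ e.ofLp) := by
      conv_lhs => rw [hve]
      rw [mul_smul, ← hAb, WithLp.ofLp_add, WithLp.ofLp_smul, Matrix.mulVec_add,
        Matrix.mulVec_smul, WithLp.toLp_add, WithLp.toLp_smul]
    have h2 : v.ofLp ⬝ᵥ (A *ᵥ v.ofLp) = inner ℝ v (WithLp.toLp 2 (A *ᵥ v.ofLp)) := by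
      rw [inner_eq_dotProduct]
    rw [h2, h1, inner_add_right, real_inner_smul_right, real_inner_comm, ← ha]
    conv_lhs => rw [hve]
    rw [inner_add_left, real_inner_smul_left, hcoord, hbe]
    ring
  have hrem : |inner ℝ e (WithLp.toLp 2 (A *ᵥ e.ofLp))| ≤ |μ i| * (1 - a ^ 2) := by
    refine (abs_real_inner_le_norm _ _).trans ?_
    rw [← hee]
    calc ‖e‖ * _ ≤ ‖e‖ * (|μ i| * ‖e‖) := by gcongr; exact hnorm e
      _ = _ := by ring
  -- The form at v is at least (2a² - 1)|μ i| in absolute value, and 2(7/8)² - 1 > 1/2.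
  have hmain : |μ i| ≤ 2 * r := by
    have h1 := h v hv
    have h2 : |a ^ 2 * μ i| ≤ r + |μ i| * (1 - a ^ 2) := by
      have h3 : a ^ 2 * μ i = v.ofLp ⬝ᵥ (A *ᵥ v.ofLp)
          - inner ℝ e (WithLp.toLp 2 (A *ᵥ e.ofLp)) := by rw [hquad]; ring
      rw [h3]
      exact (abs_sub _ _).trans (add_le_add h1 hrem)
    rw [abs_mul, abs_of_nonneg (sq_nonneg a)] at h2
    have h4 : (7 / 8) ^ 2 ≤ a ^ 2 := by gcongr
    nlinarith [abs_nonneg (μ i)]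
  exact (hnorm w).trans (by gcongr)

/-! ### Forms of positive definite matrices and their inverses -/

/-- Cauchy-Schwarz for the form of a positive definite matrix. -/
theorem abs_dotProduct_mulVec_le {n : Type*} [Fintype n] {M : Matrix n n ℝ} (hM : M.PosSemidef)
    (v w : n → ℝ) : |v ⬝ᵥ (M *ᵥ w)| ≤ √(v ⬝ᵥ (M *ᵥ v)) * √(w ⬝ᵥ (M *ᵥ w)) := by
  have hsymm : M.IsSymm := by
    have := hM.1
    rwa [Matrix.IsHermitian, Matrix.conjTranspose_eq_transpose_of_trivial] at this
  have hnn : ∀ u, 0 ≤ u ⬝ᵥ (M *ᵥ u) := fun u => by simpa using hM.dotProduct_mulVec_nonneg u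
  -- The form at v + t w is a nonnegative quadratic in t, so its discriminant is nonpositive.
  have key : ∀ t : ℝ, 0 ≤ (w ⬝ᵥ (M *ᵥ w)) * (t * t) + 2 * (v ⬝ᵥ (M *ᵥ w)) * t
      + v ⬝ᵥ (M *ᵥ v) := by
    intro t
    have h := hnn (v + t • w)
    simp only [Matrix.mulVec_add, Matrix.mulVec_smul, dotProduct_add, add_dotProduct,
      smul_dotProduct, dotProduct_smul, smul_eq_mul] at h
    rw [dotProduct_mulVec_comm hsymm w v] at h
    linarith
  have hd := discrim_le_zero key
  rw [discrim] at hd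
  rw [← Real.sqrt_mul (hnn v)]
  exact Real.abs_le_sqrt (by nlinarith)

/-- Inversion is antitone on positive definite matrices. -/
theorem dotProduct_inv_mulVec_le {n : Type*} [Fintype n] [DecidableEq n] {H W : Matrix n n ℝ}
    (hH : H.PosDef) (hW : W.PosDef) (h : ∀ y, y ⬝ᵥ (W *ᵥ y) ≤ y ⬝ᵥ (H *ᵥ y)) (v : n → ℝ) :
    v ⬝ᵥ (H⁻¹ *ᵥ v) ≤ v ⬝ᵥ (W⁻¹ *ᵥ v) := by
  have hsymm : W.IsSymm := by
    have := hW.1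
    rwa [Matrix.IsHermitian, Matrix.conjTranspose_eq_transpose_of_trivial] at this
  have hHy : H *ᵥ (H⁻¹ *ᵥ v) = v := by
    rw [Matrix.mulVec_mulVec, Matrix.mul_nonsing_inv _ ((Matrix.isUnit_iff_isUnit_det _).1 hH.isUnit),
      Matrix.one_mulVec]
  have hWz : W *ᵥ (W⁻¹ *ᵥ v) = v := by
    rw [Matrix.mulVec_mulVec, Matrix.mul_nonsing_inv _ ((Matrix.isUnit_iff_isUnit_det _).1 hW.isUnit),
      Matrix.one_mulVec]
  have h1 := h (H⁻¹ *ᵥ v)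
  -- With y = H⁻¹v and z = W⁻¹v this expands to yᵀWy - 2 y·v + z·v, and yᵀWy ≤ yᵀHy = y·v.
  have h2 : 0 ≤ (H⁻¹ *ᵥ v - W⁻¹ *ᵥ v) ⬝ᵥ (W *ᵥ (H⁻¹ *ᵥ v - W⁻¹ *ᵥ v)) := by
    simpa using hW.posSemidef.dotProduct_mulVec_nonneg (H⁻¹ *ᵥ v - W⁻¹ *ᵥ v)
  rw [Matrix.mulVec_sub, hWz, dotProduct_sub, sub_dotProduct, sub_dotProduct,
    dotProduct_mulVec_comm hsymm (W⁻¹ *ᵥ v), hWz] at h2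
  rw [hHy] at h1
  rw [dotProduct_comm v, dotProduct_comm v]
  linarith

/-- A lower bound on a matrix bounds the quadratic form of its inverse. -/
theorem dotProduct_inv_mulVec_le_div {n : Type*} [Fintype n] [DecidableEq n] {H : Matrix n n ℝ}
    (hH : H.PosDef) {c : ℝ} (hc : 0 < c) (h : ∀ y, c * (y ⬝ᵥ y) ≤ y ⬝ᵥ (H *ᵥ y)) (v : n → ℝ) :
    v ⬝ᵥ (H⁻¹ *ᵥ v) ≤ (v ⬝ᵥ v) / c := by
  have hW : (c • (1 : Matrix n n ℝ)).PosDef := Matrix.PosDef.one.smul hc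
  have := dotProduct_inv_mulVec_le hH hW (fun y => by
    simpa [Matrix.smul_mulVec, dotProduct_smul] using h y) v
  have hinv : (c • (1 : Matrix n n ℝ))⁻¹ = c⁻¹ • 1 := by
    apply Matrix.inv_eq_left_inv
    simp [smul_smul, hc.ne']
  rw [hinv, Matrix.smul_mulVec, Matrix.one_mulVec, dotProduct_smul, smul_eq_mul] at this
  rwa [div_eq_inv_mul]

/-! ### Elliptical potential -/

/-- The regularized Gram matrix `l I + ∑ x xᵀ`. -/
def gram {d : ℕ} (l : ℝ) (x : ℕ → EuclideanSpace ℝ (Fin d)) (t : ℕ) : Matrix (Fin d) (Fin d) ℝ :=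
  l • 1 + ∑ s ∈ Finset.range t, Matrix.vecMulVec (x s).ofLp (x s).ofLp

theorem gram_succ {d : ℕ} (l : ℝ) (x : ℕ → EuclideanSpace ℝ (Fin d)) (t : ℕ) :
    gram l x (t + 1) = gram l x t + Matrix.vecMulVec (x t).ofLp (x t).ofLp := by
  rw [gram, gram, Finset.sum_range_succ, add_assoc]

theorem posSemidef_sum_vecMulVec {d : ℕ} (x : ℕ → EuclideanSpace ℝ (Fin d)) (t : ℕ) :
    (∑ s ∈ Finset.range t, Matrix.vecMulVec (x s).ofLp (x s).ofLp).PosSemidef :=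
  Matrix.posSemidef_sum _ fun s _ => by simpa using Matrix.posSemidef_vecMulVec_self_star (x s).ofLp

theorem posDef_gram {d : ℕ} {l : ℝ} (hl : 0 < l) (x : ℕ → EuclideanSpace ℝ (Fin d)) (t : ℕ) :
    (gram l x t).PosDef :=
  (Matrix.PosDef.one.smul hl).add_posSemidef (posSemidef_sum_vecMulVec x t)

/-- The matrix determinant lemma for a rank-one update; it makes the logarithm of the determinant
telescope into the potential. -/
theorem det_gram_succ {d : ℕ} {l : ℝ} (hl : 0 < l) (x : ℕ → EuclideanSpace ℝ (Fin d)) (t : ℕ) :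
    (gram l x (t + 1)).det =
      (gram l x t).det * (1 + (x t).ofLp ⬝ᵥ ((gram l x t)⁻¹ *ᵥ (x t).ofLp)) := by
  rw [gram_succ, Matrix.vecMulVec_eq Unit, Matrix.det_add_replicateCol_mul_replicateRow
    ((Matrix.isUnit_iff_isUnit_det _).1 (posDef_gram hl x t).isUnit)]
  congr 1
  rw [Matrix.det_unique, Matrix.add_apply, Matrix.one_apply_eq, Matrix.mul_assoc,
    ← Matrix.replicateCol_mulVec, Matrix.replicateRow_mul_replicateCol_apply]

theorem dotProduct_gram_mulVec_le {d : ℕ} {l : ℝ} {x : ℕ → EuclideanSpace ℝ (Fin d)}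
    {t : ℕ} (hx : ∀ s < t, ‖x s‖ ≤ 1) (v : EuclideanSpace ℝ (Fin d)) :
    v.ofLp ⬝ᵥ (gram l x t *ᵥ v.ofLp) ≤ (l + t) * ‖v‖ ^ 2 := by
  have h1 : v.ofLp ⬝ᵥ (gram l x t *ᵥ v.ofLp)
      = l * ‖v‖ ^ 2 + ∑ s ∈ Finset.range t, inner ℝ (x s) v ^ 2 := by
    rw [gram, Matrix.add_mulVec, dotProduct_add, Matrix.smul_mulVec, Matrix.one_mulVec,
      dotProduct_smul, Matrix.sum_mulVec, dotProduct_sum, ← inner_eq_dotProduct,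
      real_inner_self_eq_norm_sq, smul_eq_mul]
    congr 1
    refine Finset.sum_congr rfl fun s _ => ?_
    rw [Matrix.vecMulVec_mulVec, inner_eq_dotProduct]
    simp [dotProduct_smul, dotProduct_comm, sq]
  rw [h1, add_mul]
  gcongr
  calc _ ≤ ∑ s ∈ Finset.range t, ‖v‖ ^ 2 := by
        refine Finset.sum_le_sum fun s hs => ?_
        have := abs_real_inner_le_norm (x s) v
        rw [← sq_abs]
        gcongr
        exact this.trans (mul_le_of_le_one_left (norm_nonneg _) (hx s (Finset.mem_range.1 hs)))
    _ = _ := by simp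

/-- Each eigenvalue is the form at a unit eigenvector, hence at most l + t. -/
theorem det_gram_le {d : ℕ} {l : ℝ} (hl : 0 < l) {x : ℕ → EuclideanSpace ℝ (Fin d)}
    {t : ℕ} (hx : ∀ s < t, ‖x s‖ ≤ 1) : (gram l x t).det ≤ (l + t) ^ d := by
  have hP := posDef_gram hl x t
  rw [hP.1.det_eq_prod_eigenvalues]
  have : ∏ i : Fin d, (l + t : ℝ) = (l + t) ^ d := by simp
  rw [← this]
  refine Finset.prod_le_prod (fun i _ => (hP.eigenvalues_pos i).le) fun i _ => ?_
  have h1 := hP.1.eigenvalues_eq i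
  have h2 := dotProduct_gram_mulVec_le (l := l) hx (hP.1.eigenvectorBasis i)
  rw [hP.1.eigenvectorBasis.orthonormal.1 i] at h2
  simp at h1 ⊢
  rw [h1]
  simpa using h2

/-- The elliptical potential lemma. -/
theorem sum_min_le_log {d : ℕ} {l : ℝ} (hl : 0 < l) {x : ℕ → EuclideanSpace ℝ (Fin d)}
    {t : ℕ} (hx : ∀ s < t, ‖x s‖ ≤ 1) :
    ∑ s ∈ Finset.range t, min 1 ((x s).ofLp ⬝ᵥ ((gram l x s)⁻¹ *ᵥ (x s).ofLp))
      ≤ 2 * (d * Real.log (1 + t / l)) := by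
  have hnn : ∀ s, 0 ≤ (x s).ofLp ⬝ᵥ ((gram l x s)⁻¹ *ᵥ (x s).ofLp) := fun s => by
    simpa using (posDef_gram hl x s).inv.posSemidef.dotProduct_mulVec_nonneg (x s).ofLp
  have hlog : ∀ n, Real.log ((gram l x n).det) = d * Real.log l +
      ∑ s ∈ Finset.range n, Real.log (1 + (x s).ofLp ⬝ᵥ ((gram l x s)⁻¹ *ᵥ (x s).ofLp)) := by
    intro n
    induction n with
    | zero => simp [gram, Real.log_pow]
    | succ n ih =>
      rw [det_gram_succ hl, Real.log_mul (posDef_gram hl x n).det_pos.ne'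
        (by linarith [hnn n]), ih, Finset.sum_range_succ, add_assoc]
  have hdet : Real.log ((gram l x t).det) ≤ d * Real.log (l + t) := by
    rw [← Real.log_pow]
    exact Real.log_le_log (posDef_gram hl x t).det_pos (det_gram_le hl hx)
  have hsplit : Real.log (1 + t / l) = Real.log (l + t) - Real.log l := by
    rw [← Real.log_div (by positivity) hl.ne']
    congr 1
    field_simp
  -- With m = min 1 u, log (1 + m) ≥ m / (1 + m) ≥ m / 2.
  have hmin : ∀ u : ℝ, 0 ≤ u → min 1 u ≤ 2 * Real.log (1 + u) := by
    intro u hu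
    have h1 : 1 - (1 + min 1 u)⁻¹ ≤ Real.log (1 + min 1 u) :=
      Real.one_sub_inv_le_log_of_pos (by positivity)
    have h2 : Real.log (1 + min 1 u) ≤ Real.log (1 + u) :=
      Real.log_le_log (by positivity) (by gcongr; exact min_le_right _ _)
    have hm0 : 0 ≤ min 1 u := le_min zero_le_one hu
    have h3 : min 1 u / 2 ≤ 1 - (1 + min 1 u)⁻¹ := by
      have : 1 - (1 + min 1 u)⁻¹ = min 1 u / (1 + min 1 u) := by field_simp; ring
      rw [this]
      gcongr
      linarith [min_le_left 1 u]
    linarith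
  calc _ ≤ ∑ s ∈ Finset.range t,
        2 * Real.log (1 + (x s).ofLp ⬝ᵥ ((gram l x s)⁻¹ *ᵥ (x s).ofLp)) :=
        Finset.sum_le_sum fun s _ => hmin _ (hnn s)
    _ = 2 * (Real.log ((gram l x t).det) - d * Real.log l) := by
        rw [hlog, ← Finset.mul_sum]; ring
    _ ≤ _ := by rw [hsplit]; linarith

/-! ### Sub-Gaussian sums -/

open scoped NNReal

theorem measure_le_of_hasSubgaussianMGF {Ω : Type*} {mΩ : MeasurableSpace Ω} {μ : Measure Ω}
    [IsProbabilityMeasure μ] {X : Ω → ℝ} {c : ℝ≥0} (h : HasSubgaussianMGF X c μ) (hc : 0 < c)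
    {E r : ℝ} (hE : 0 ≤ E) (hEr : E ^ 2 = 2 * c * r) :
    μ {ω | E ≤ X ω} ≤ ENNReal.ofReal (Real.exp (-r)) := by
  have h1 := h.measure_ge_le hE
  rw [hEr, neg_div, mul_div_cancel_left₀ _ (by positivity)] at h1
  rw [← ofReal_measureReal]
  exact ENNReal.ofReal_le_ofReal h1

/-- Linear forms of independent centered Gaussians are sub-Gaussian. -/
theorem hasSubgaussianMGF_sum_gaussian {ι : Type*} [Fintype ι] (v : ℝ≥0) (a : ι → ℝ) {c : ℝ≥0}
    (hc : (∑ i, a i ^ 2) * v ≤ c) :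
    HasSubgaussianMGF (fun z : ι → ℝ => ∑ i, a i * z i) c
      (Measure.pi fun _ => gaussianReal 0 v) := by
  have hind : iIndepFun (fun i (z : ι → ℝ) => a i * z i)
      (Measure.pi fun _ : ι => gaussianReal 0 v) :=
    iIndepFun_pi (X := fun i x => a i * x) fun i => by fun_prop
  have hone : ∀ i, HasSubgaussianMGF (fun z : ι → ℝ => a i * z i) (Real.toNNReal (a i ^ 2) * v)
      (Measure.pi fun _ : ι => gaussianReal 0 v) := by
    intro i
    have hg : HasSubgaussianMGF (fun x : ℝ => a i * x) (Real.toNNReal (a i ^ 2) * v)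
        (gaussianReal 0 v) := by
      refine ⟨fun t => ?_, fun t => ?_⟩
      · simpa [mul_assoc] using integrable_exp_mul_gaussianReal (μ := 0) (v := v) (t * a i)
      · have h1 : mgf (fun x : ℝ => a i * x) (gaussianReal 0 v) t
            = mgf id (gaussianReal 0 v) (t * a i) := by simp [mgf, mul_assoc]
        rw [h1, mgf_id_gaussianReal]
        apply le_of_eq
        simp only [NNReal.coe_mul, Real.coe_toNNReal _ (sq_nonneg (a i))]
        congr 1
        ring
    have hmp := measurePreserving_eval (fun _ : ι => gaussianReal 0 v) i
    refine HasSubgaussianMGF.of_map (X := fun x : ℝ => a i * x) (Y := Function.eval i)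
      hmp.measurable.aemeasurable ?_
    rw [hmp.map_eq]
    exact hg
  have hsum := HasSubgaussianMGF.sum_of_iIndepFun hind (s := Finset.univ) fun i _ => hone i
  refine ⟨hsum.integrable_exp_mul, fun t => (hsum.mgf_le t).trans (Real.exp_le_exp.2 ?_)⟩
  have : ((∑ i, Real.toNNReal (a i ^ 2) * v : ℝ≥0) : ℝ) ≤ c := by
    refine le_trans (le_of_eq ?_) hc
    simp [Finset.sum_mul, max_eq_left (sq_nonneg _)]
  gcongr

/-- Sums of a function of fresh noise. -/
theorem hasSubgaussianMGF_sum_fresh {Ω S : Type*} {mΩ : MeasurableSpace Ω} {mS : MeasurableSpace S}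
    {μ : Measure Ω} [IsProbabilityMeasure μ] {𝓕 : Filtration ℕ mΩ} {z : ℕ → Ω → S} {ν : Measure S}
    {T : ℕ} (hmeas : ∀ t < T, Measurable[𝓕 (t + 1)] (z t)) (hlaw : ∀ t < T, HasLaw (z t) ν μ)
    (hind : ∀ t < T, Indep (MeasurableSpace.comap (z t) mS) (𝓕 t) μ)
    {f : S → ℝ} (hf : Measurable f) {c : ℝ≥0} (hsub : HasSubgaussianMGF f c ν) :
    ∀ t ≤ T, HasSubgaussianMGF (fun ω => ∑ s ∈ Finset.range t, f (z s ω)) (t * c) μ := by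
  intro t
  induction t with
  | zero => simp
  | succ t ih =>
    intro ht
    have h1 := ih (Nat.le_of_succ_le ht)
    have h2 : HasSubgaussianMGF (fun ω => f (z t ω)) c μ :=
      HasSubgaussianMGF.of_map (X := f) (Y := z t) (hlaw t ht).aemeasurable
        ((hlaw t ht).map_eq ▸ hsub)
    have hM : Measurable[𝓕 t] (fun ω => ∑ s ∈ Finset.range t, f (z s ω)) := by
      refine Finset.measurable_sum _ fun s hs => ?_
      have hst := Finset.mem_range.1 hs
      exact hf.comp ((hmeas s (hst.trans ht)).mono (𝓕.mono hst) le_rfl)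
    -- The earlier sum is measurable for `𝓕 t`, from which the fresh noise is independent.
    have hi : IndepFun (fun ω => ∑ s ∈ Finset.range t, f (z s ω)) (fun ω => f (z t ω)) μ := by
      refine (IndepFun_iff_Indep _ _ _).2 (indep_of_indep_of_le_left
        (indep_of_indep_of_le_right (hind t ht).symm ?_) hM.comap_le)
      rw [show (fun ω => f (z t ω)) = f ∘ z t from rfl, ← MeasurableSpace.comap_comp]
      exact MeasurableSpace.comap_mono hf.comap_le
    have h3 := h1.add_of_indepFun h2 hi
    simp_rw [Finset.sum_range_succ]
    convert! h3 using 1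
    push_cast
    ring

/-- Convexity of exp: y a is the mean of a and -a with weights (1 ± y)/2. The right side is affine
in y, so a conditional mean zero removes the sinh term. -/
theorem exp_mul_le_cosh_add {a y : ℝ} (hy : |y| ≤ 1) :
    Real.exp (y * a) ≤ Real.cosh a + y * Real.sinh a := by
  obtain ⟨h1, h2⟩ := abs_le.1 hy
  have h := convexOn_exp.2 (Set.mem_univ a) (Set.mem_univ (-a))
    (show 0 ≤ (1 + y) / 2 by linarith) (show 0 ≤ (1 - y) / 2 by linarith) (by ring)
  simp only [smul_eq_mul] at h
  rw [Real.cosh_eq, Real.sinh_eq]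
  calc _ = Real.exp ((1 + y) / 2 * a + (1 - y) / 2 * -a) := by ring_nf
    _ ≤ _ := h
    _ = _ := by ring

/-- Predictable transforms of bounded martingale differences are sub-Gaussian. -/
theorem hasSubgaussianMGF_sum_predictable {Ω : Type*} {mΩ : MeasurableSpace Ω}
    {μ : Measure Ω} [IsProbabilityMeasure μ] {𝓕 : Filtration ℕ mΩ} {η a : ℕ → Ω → ℝ} {T : ℕ}
    (ha : ∀ t < T, Measurable[𝓕 t] (a t)) (ha1 : ∀ t < T, ∀ ω, |a t ω| ≤ 1)
    (hη : ∀ t < T, Measurable[𝓕 (t + 1)] (η t)) (hη1 : ∀ t < T, ∀ᵐ ω ∂μ, |η t ω| ≤ 1)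
    (hη0 : ∀ t < T, μ[η t | 𝓕 t] =ᵐ[μ] 0) :
    ∀ t ≤ T, HasSubgaussianMGF (fun ω => ∑ s ∈ Finset.range t, η s ω * a s ω) t μ := by
  have hmeas : ∀ t ≤ T, Measurable[𝓕 t] (fun ω => ∑ s ∈ Finset.range t, η s ω * a s ω) := by
    intro t ht
    refine Finset.measurable_sum _ fun s hs => ?_
    have hst := Finset.mem_range.1 hs
    exact ((hη s (hst.trans_le ht)).mono (𝓕.mono hst) le_rfl).mul
      ((ha s (hst.trans_le ht)).mono (𝓕.mono hst.le) le_rfl)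
  have hbdd : ∀ t ≤ T, ∀ᵐ ω ∂μ, |∑ s ∈ Finset.range t, η s ω * a s ω| ≤ t := by
    intro t ht
    have h1 : ∀ᵐ ω ∂μ, ∀ s : Fin t, |η s ω| ≤ 1 :=
      ae_all_iff.2 fun s => hη1 s (s.2.trans_le ht)
    filter_upwards [h1] with ω hω
    calc _ ≤ ∑ s ∈ Finset.range t, |η s ω * a s ω| := Finset.abs_sum_le_sum_abs _ _
      _ ≤ ∑ s ∈ Finset.range t, (1 : ℝ) := by
        refine Finset.sum_le_sum fun s hs => ?_
        have hst := Finset.mem_range.1 hs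
        rw [abs_mul]
        exact mul_le_one₀ (hω ⟨s, hst⟩) (abs_nonneg _) (ha1 s (hst.trans_le ht) ω)
      _ = t := by simp
  have hexpb : ∀ t ≤ T, ∀ l : ℝ, ∀ᵐ ω ∂μ,
      ‖Real.exp (l * ∑ s ∈ Finset.range t, η s ω * a s ω)‖ ≤ Real.exp (|l| * t) := by
    intro t ht l
    filter_upwards [hbdd t ht] with ω hω
    rw [Real.norm_eq_abs, Real.abs_exp]
    refine Real.exp_le_exp.2 ((le_abs_self _).trans ?_)
    rw [abs_mul]
    gcongr
  have hint : ∀ t ≤ T, ∀ l : ℝ,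
      Integrable (fun ω => Real.exp (l * ∑ s ∈ Finset.range t, η s ω * a s ω)) μ := by
    intro t ht l
    refine Integrable.of_bound ?_ _ (hexpb t ht l)
    exact (((hmeas t ht).mono (𝓕.le t) le_rfl).const_mul l).exp.aestronglyMeasurable
  intro t ht
  refine ⟨hint t ht, fun l => ?_⟩
  induction t with
  | zero => simp [mgf]
  | succ t ih =>
    have htT : t < T := ht
    set M : Ω → ℝ := fun ω => ∑ s ∈ Finset.range t, η s ω * a s ω with hM
    have hηm : Measurable (η t) := (hη t htT).mono (𝓕.le _) le_rfl
    have ham : Measurable (a t) := (ha t htT).mono (𝓕.le _) le_rfl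
    have hηint : Integrable (η t) μ :=
      Integrable.of_bound hηm.aestronglyMeasurable 1 (hη1 t htT)
    have hgm : Measurable[𝓕 t] (fun ω => Real.exp (l * M ω) * Real.sinh (l * a t ω)) :=
      ((hmeas t htT.le).const_mul l).exp.mul (Real.measurable_sinh.comp ((ha t htT).const_mul l))
    have hal : ∀ ω, |l * a t ω| ≤ |l| := fun ω => by
      rw [abs_mul]; exact mul_le_of_le_one_right (abs_nonneg _) (ha1 t htT ω)
    have hgb : ∀ᵐ ω ∂μ, ‖Real.exp (l * M ω) * Real.sinh (l * a t ω)‖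
        ≤ Real.exp (|l| * t) * Real.sinh |l| := by
      filter_upwards [hexpb t htT.le l] with ω hω
      rw [norm_mul]
      gcongr
      rw [Real.norm_eq_abs, Real.abs_sinh]
      exact Real.sinh_le_sinh.2 (hal ω)
    have hgη : Integrable ((fun ω => Real.exp (l * M ω) * Real.sinh (l * a t ω)) * η t) μ :=
      hηint.bdd_mul (hgm.mono (𝓕.le t) le_rfl).aestronglyMeasurable hgb
    -- The factor multiplying `η t` is known at time t, and `η t` has conditional mean zero.
    have hzero : ∫ ω, ((fun ω => Real.exp (l * M ω) * Real.sinh (l * a t ω)) * η t) ω ∂μ = 0 := by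
      rw [← integral_condExp (𝓕.le t)]
      have h1 := condExp_mul_of_stronglyMeasurable_left hgm.stronglyMeasurable hgη hηint
      have h2 : μ[(fun ω => Real.exp (l * M ω) * Real.sinh (l * a t ω)) * η t | 𝓕 t] =ᵐ[μ] 0 := by
        filter_upwards [h1, hη0 t htT] with ω h3 h4
        rw [h3, Pi.mul_apply, h4]
        simp
      rw [integral_congr_ae h2]
      simp
    have hcosh : ∀ ω, Real.cosh (l * a t ω) ≤ Real.exp (l ^ 2 / 2) := by
      intro ω
      refine (Real.cosh_le_exp_half_sq _).trans (Real.exp_le_exp.2 ?_)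
      have := hal ω
      rw [← sq_abs, ← sq_abs l]
      gcongr
    have hcint : Integrable (fun ω => Real.exp (l * M ω) * Real.exp (l ^ 2 / 2)) μ :=
      (hint t htT.le l).mul_const _
    calc mgf (fun ω => ∑ s ∈ Finset.range (t + 1), η s ω * a s ω) μ l
        ≤ ∫ ω, (Real.exp (l * M ω) * Real.exp (l ^ 2 / 2)
          + ((fun ω => Real.exp (l * M ω) * Real.sinh (l * a t ω)) * η t) ω) ∂μ := by
          refine integral_mono_ae (hint (t + 1) ht l) (hcint.add hgη) ?_
          filter_upwards [hη1 t htT] with ω hω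
          simp only [Finset.sum_range_succ, mul_add, Real.exp_add, Pi.mul_apply]
          have h1 := exp_mul_le_cosh_add (a := l * a t ω) hω
          have h2 : l * (η t ω * a t ω) = η t ω * (l * a t ω) := by ring
          rw [h2]
          have h3 := Real.exp_pos (l * M ω)
          have h4 := hcosh ω
          calc _ ≤ Real.exp (l * M ω) * (Real.exp (l ^ 2 / 2) + η t ω * Real.sinh (l * a t ω)) := by
                gcongr
                linarith
            _ = _ := by ring
      _ = mgf M μ l * Real.exp (l ^ 2 / 2) := by
          rw [integral_add hcint hgη, hzero, add_zero, integral_mul_const]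
          rfl
      _ ≤ Real.exp ((t : ℝ≥0) * l ^ 2 / 2) * Real.exp (l ^ 2 / 2) := by
          gcongr
          exact ih htT.le
      _ = _ := by
          rw [← Real.exp_add]
          push_cast
          ring_nf

/-! ### Concentration of the accumulated noises -/

/-- The quadratic form of the noise matrix at a unit vector. -/
theorem hasSubgaussianMGF_quadratic_noiseMatrix (P : Params) {v : Vec P} (hv : ‖v‖ = 1) :
    HasSubgaussianMGF (fun z => v.ofLp ⬝ᵥ (noiseMatrix P z *ᵥ v.ofLp))
      (2 * Real.toNNReal (sigma P ^ 2)) (noiseLaw P) := by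
  classical
  let g : Fin P.d × Fin P.d → NoiseIdx P := fun q => Sum.inl ⟨(min q.1 q.2, max q.1 q.2), min_le_max⟩
  let a : NoiseIdx P → ℝ := fun k => ∑ q with g q = k, v q.1 * v q.2
  have hform : ∀ z : NoiseIdx P → ℝ, v.ofLp ⬝ᵥ (noiseMatrix P z *ᵥ v.ofLp) = ∑ k, a k * z k := by
    intro z
    have h1 : v.ofLp ⬝ᵥ (noiseMatrix P z *ᵥ v.ofLp)
        = ∑ q : Fin P.d × Fin P.d, v q.1 * v q.2 * z (g q) := by
      rw [Fintype.sum_prod_type]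
      simp only [dotProduct, Matrix.mulVec, noiseMatrix, Matrix.of_apply, Finset.mul_sum, g]
      refine Finset.sum_congr rfl fun i _ => Finset.sum_congr rfl fun j _ => ?_
      ring
    rw [h1, ← Finset.sum_fiberwise Finset.univ g]
    refine Finset.sum_congr rfl fun k _ => ?_
    rw [Finset.sum_mul]
    refine Finset.sum_congr rfl fun q hq => ?_
    rw [(Finset.mem_filter.1 hq).2]
  -- An off-diagonal noise occupies the two positions (i, j) and (j, i). Cauchy-Schwarz on these
  -- fibres gives the variance factor 2.
  have hcard : ∀ k, ((Finset.univ.filter fun q => g q = k).card : ℝ) ≤ 2 := by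
    intro k
    rcases (Finset.univ.filter fun q => g q = k).eq_empty_or_nonempty with h | ⟨q₀, h₀⟩
    · simp [h]
    · have hsub : (Finset.univ.filter fun q => g q = k) ⊆ {q₀, q₀.swap} := by
        intro q hq
        have h1 : g q = g q₀ := (Finset.mem_filter.1 hq).2.trans (Finset.mem_filter.1 h₀).2.symm
        simp only [g, Sum.inl.injEq, Subtype.mk.injEq, Prod.mk.injEq] at h1
        rw [Finset.mem_insert, Finset.mem_singleton]
        obtain ⟨i, j⟩ := q
        obtain ⟨i', j'⟩ := q₀
        simp only [Prod.swap_prod_mk, Prod.mk.injEq]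
        simp only [Fin.ext_iff, Fin.coe_min, Fin.coe_max] at h1 ⊢
        omega
      exact_mod_cast (Finset.card_le_card hsub).trans Finset.card_le_two
  have hsq : ∑ k, a k ^ 2 ≤ 2 := by
    have h1 : ∑ q : Fin P.d × Fin P.d, (v q.1 * v q.2) ^ 2 = 1 := by
      rw [Fintype.sum_prod_type]
      simp_rw [mul_pow, ← Finset.mul_sum, ← Finset.sum_mul]
      have : ∑ i, v i ^ 2 = 1 := by
        rw [← EuclideanSpace.real_norm_sq_eq, hv, one_pow]
      rw [this, one_mul]
    calc ∑ k, a k ^ 2 ≤ ∑ k, 2 * ∑ q with g q = k, (v q.1 * v q.2) ^ 2 := by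
          refine Finset.sum_le_sum fun k _ => sq_sum_le_card_mul_sum_sq.trans ?_
          gcongr
          exact hcard k
      _ = 2 := by rw [← Finset.mul_sum, Finset.sum_fiberwise, h1, mul_one]
  simp_rw [hform]
  refine hasSubgaussianMGF_sum_gaussian _ a ?_
  push_cast
  gcongr

theorem hasSubgaussianMGF_inner_noiseVector (P : Params) {v : Vec P} (hv : ‖v‖ = 1) :
    HasSubgaussianMGF (fun z => v.ofLp ⬝ᵥ noiseVector P z)
      (Real.toNNReal (sigma P ^ 2)) (noiseLaw P) := by
  have hform : ∀ z : NoiseIdx P → ℝ, v.ofLp ⬝ᵥ noiseVector P z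
      = ∑ k, Sum.elim (fun _ => 0) v.ofLp k * z k := by
    intro z
    simp [Fintype.sum_sum_type, dotProduct, noiseVector]
  simp_rw [hform]
  refine hasSubgaussianMGF_sum_gaussian _ _ ?_
  have : ∑ i, v i ^ 2 = 1 := by
    rw [← EuclideanSpace.real_norm_sq_eq, hv, one_pow]
  simp [Fintype.sum_sum_type, this]

/-- Off an event of probability at most `4 T 5 ^ d exp (-r)`, all accumulated noises are small
along the directions of a net. -/
theorem IsRun.exists_bad_event {P : Params} {Ω : Type*} {mΩ : MeasurableSpace Ω} {μ : Measure Ω}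
    [IsProbabilityMeasure μ] {𝓕 : Filtration ℕ mΩ} {θ : Vec P} {D : ℕ → Ω → Set (Vec P)}
    {x xs : ℕ → Ω → Vec P} {η : ℕ → Ω → ℝ} {z : ℕ → Ω → NoiseIdx P → ℝ}
    (h : IsRun P μ 𝓕 θ D x xs η z) (hσ : 0 < sigma P) {s : Finset (Vec P)} (hs : IsSphereNet s)
    (hcard : s.card ≤ 5 ^ P.d) {r : ℝ} (hr : 0 ≤ r) :
    ∃ bad : Set Ω, μ bad ≤ ENNReal.ofReal (4 * P.T * 5 ^ P.d * Real.exp (-r)) ∧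
      ∀ ω ∉ bad, ∀ t, 1 ≤ t → t < P.T → ∀ v ∈ s,
        |∑ i ∈ Finset.range t, v.ofLp ⬝ᵥ (noiseMatrix P (z i ω) *ᵥ v.ofLp)|
          ≤ 2 * sigma P * √t * √r ∧
        ∑ i ∈ Finset.range t, v.ofLp ⬝ᵥ noiseVector P (z i ω) ≤ 2 * sigma P * √t * √r ∧
        ∑ i ∈ Finset.range t, η i ω * inner ℝ v (x i ω) ≤ 2 * √t * √r := by
  have hσ2 : (0 : ℝ≥0) < Real.toNNReal (sigma P ^ 2) := Real.toNNReal_pos.2 (by positivity)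
  have hσc : ((Real.toNNReal (sigma P ^ 2) : ℝ≥0) : ℝ) = sigma P ^ 2 :=
    Real.coe_toNNReal _ (sq_nonneg _)
  have hind : ∀ t < P.T, Indep (MeasurableSpace.comap (z t) inferInstance) (𝓕 t) μ := fun t ht =>
    indep_of_indep_of_le_right (h.priv_indep t ht) le_sup_left
  let A : ℕ → Vec P → Ω → ℝ := fun t v ω =>
    ∑ i ∈ Finset.range t, v.ofLp ⬝ᵥ (noiseMatrix P (z i ω) *ᵥ v.ofLp)
  let B : ℕ → Vec P → Ω → ℝ := fun t v ω =>
    ∑ i ∈ Finset.range t, v.ofLp ⬝ᵥ noiseVector P (z i ω)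
  let C : ℕ → Vec P → Ω → ℝ := fun t v ω => ∑ i ∈ Finset.range t, η i ω * inner ℝ v (x i ω)
  let E : ℕ → Vec P → Set Ω := fun t v =>
    ({ω | 2 * sigma P * √t * √r ≤ A t v ω} ∪ {ω | 2 * sigma P * √t * √r ≤ (-A t v) ω}) ∪
    ({ω | 2 * sigma P * √t * √r ≤ B t v ω} ∪ {ω | 2 * √t * √r ≤ C t v ω})
  have hE : ∀ t ∈ Finset.Ico 1 P.T, ∀ v ∈ s, μ (E t v) ≤ ENNReal.ofReal (4 * Real.exp (-r)) := by
    intro t ht v hv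
    obtain ⟨ht1, htT⟩ := Finset.mem_Ico.1 ht
    have hv1 := hs.1 v hv
    have ht0 : (0 : ℝ≥0) < t := by exact_mod_cast ht1
    have hsub : ∀ {X : Ω → ℝ} {c : ℝ≥0}, HasSubgaussianMGF X c μ → 0 < c → ∀ {e : ℝ}, 0 ≤ e →
        2 * c * r ≤ e ^ 2 → μ {ω | e ≤ X ω} ≤ ENNReal.ofReal (Real.exp (-r)) := by
      intro X c hX hc e he hle
      refine (measure_mono fun ω (hω : e ≤ X ω) => ?_).trans (measure_le_of_hasSubgaussianMGF hX hc
        (Real.sqrt_nonneg (2 * c * r)) (Real.sq_sqrt (by positivity)))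
      exact (Real.sqrt_le_left he |>.2 hle).trans hω
    have hA : HasSubgaussianMGF (A t v) (t * (2 * Real.toNNReal (sigma P ^ 2))) μ :=
      hasSubgaussianMGF_sum_fresh h.priv_meas h.priv_law hind
        (f := fun z => v.ofLp ⬝ᵥ (noiseMatrix P z *ᵥ v.ofLp))
        (by simp only [dotProduct, Matrix.mulVec, noiseMatrix, Matrix.of_apply]; fun_prop)
        (hasSubgaussianMGF_quadratic_noiseMatrix P hv1) t htT.le
    have hB : HasSubgaussianMGF (B t v) (t * Real.toNNReal (sigma P ^ 2)) μ :=
      hasSubgaussianMGF_sum_fresh h.priv_meas h.priv_law hind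
        (f := fun z => v.ofLp ⬝ᵥ noiseVector P z)
        (by simp only [dotProduct, noiseVector]; fun_prop)
        (hasSubgaussianMGF_inner_noiseVector P hv1) t htT.le
    have hC : HasSubgaussianMGF (C t v) t μ := by
      refine hasSubgaussianMGF_sum_predictable (a := fun i ω => inner ℝ v (x i ω)) ?_ ?_
        h.noise_meas h.noise_bdd h.noise_mean t htT.le
      · exact fun i hi => (h.action_meas i hi).const_inner
      · intro i hi ω
        refine (abs_real_inner_le_norm _ _).trans ?_
        rw [hv1, one_mul]
        exact h.norm_action i hi ω _ (h.action_mem i hi ω)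
    -- For the matrix form with variance proxy 2σ²t, this threshold gives exactly the tail exp (-r);
    -- for the other sums there is room to spare.
    have e1 : (2 * sigma P * √t * √r) ^ 2 = 4 * (sigma P ^ 2 * t * r) := by
      rw [mul_pow, mul_pow, mul_pow, Real.sq_sqrt (Nat.cast_nonneg t), Real.sq_sqrt hr]; ring
    have e2 : (2 * √t * √r) ^ 2 = 4 * (t * r) := by
      rw [mul_pow, mul_pow, Real.sq_sqrt (Nat.cast_nonneg t), Real.sq_sqrt hr]; ring
    have p1 : 0 ≤ sigma P ^ 2 * t * r := by positivity
    have p2 : 0 ≤ t * r := by positivity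
    have q1 := hsub hA (by positivity) (e := 2 * sigma P * √t * √r) (by positivity)
      (by rw [e1]; push_cast; rw [hσc]; linarith)
    have q2 := hsub hA.neg (by positivity) (e := 2 * sigma P * √t * √r) (by positivity)
      (by rw [e1]; push_cast; rw [hσc]; linarith)
    have q3 := hsub hB (by positivity) (e := 2 * sigma P * √t * √r) (by positivity)
      (by rw [e1]; push_cast; rw [hσc]; linarith)
    have q4 := hsub hC ht0 (e := 2 * √t * √r) (by positivity)
      (by rw [e2]; push_cast; linarith)
    have h4 : ENNReal.ofReal (4 * Real.exp (-r)) =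
        (ENNReal.ofReal (Real.exp (-r)) + ENNReal.ofReal (Real.exp (-r))) +
        (ENNReal.ofReal (Real.exp (-r)) + ENNReal.ofReal (Real.exp (-r))) := by
      have := Real.exp_pos (-r)
      rw [← ENNReal.ofReal_add this.le this.le, ← ENNReal.ofReal_add (by positivity) (by positivity)]
      congr 1
      ring
    rw [h4]
    exact (measure_union_le _ _).trans (add_le_add ((measure_union_le _ _).trans (add_le_add q1 q2))
      ((measure_union_le _ _).trans (add_le_add q3 q4)))
  refine ⟨⋃ t ∈ Finset.Ico 1 P.T, ⋃ v ∈ s, E t v, ?_, ?_⟩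
  · calc _ ≤ ∑ t ∈ Finset.Ico 1 P.T, ∑ v ∈ s, μ (E t v) :=
          (measure_biUnion_finset_le _ _).trans
            (Finset.sum_le_sum fun t _ => measure_biUnion_finset_le _ _)
      _ ≤ ∑ t ∈ Finset.Ico 1 P.T, ∑ v ∈ s, ENNReal.ofReal (4 * Real.exp (-r)) :=
          Finset.sum_le_sum fun t ht => Finset.sum_le_sum fun v hv => hE t ht v hv
      _ = ENNReal.ofReal (((P.T - 1 : ℕ) : ℝ) * (s.card * (4 * Real.exp (-r)))) := by
          rw [ENNReal.ofReal_mul (by positivity), ENNReal.ofReal_mul (by positivity)]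
          simp
      _ ≤ _ := by
          refine ENNReal.ofReal_le_ofReal ?_
          have h1 : ((P.T - 1 : ℕ) : ℝ) ≤ P.T := by exact_mod_cast Nat.sub_le _ _
          have h2 : (s.card : ℝ) ≤ 5 ^ P.d := by exact_mod_cast hcard
          calc _ ≤ (P.T : ℝ) * (5 ^ P.d * (4 * Real.exp (-r))) := by gcongr
            _ = _ := by ring
  · intro ω hω t ht1 htT v hv
    have hn : ω ∉ E t v := fun hE' => hω (Set.mem_biUnion (Finset.mem_coe.2
      (Finset.mem_Ico.2 ⟨ht1, htT⟩)) (Set.mem_biUnion hv hE'))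
    simp only [E, Set.mem_union, Set.mem_ofPred_eq, not_or, not_le, Pi.neg_apply] at hn
    obtain ⟨⟨n1, n2⟩, n3, n4⟩ := hn
    exact ⟨abs_le.2 ⟨by linarith, n1.le⟩, n3.le, n4.le⟩

/-! ### The regularized estimator under bounded noise -/

/-- The accumulated matrix noise. -/
def noiseSum (P : Params) (z : ℕ → NoiseIdx P → ℝ) (t : ℕ) : Matrix (Fin P.d) (Fin P.d) ℝ :=
  ∑ s ∈ Finset.range t, noiseMatrix P (z s)

theorem isSymm_noiseSum (P : Params) (z : ℕ → NoiseIdx P → ℝ) (t : ℕ) : (noiseSum P z t).IsSymm := by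
  ext i j
  simp [noiseSum, Matrix.sum_apply, noiseMatrix, min_comm, max_comm]

theorem serverMatrix_add_smul (P : Params) (x : ℕ → Vec P) (z : ℕ → NoiseIdx P → ℝ) (t : ℕ)
    (c : ℝ) : serverMatrix P x z t + c • (1 : Matrix (Fin P.d) (Fin P.d) ℝ)
      = gram c x t + noiseSum P z t := by
  rw [serverMatrix, gram, noiseSum, Finset.sum_add_distrib]
  abel

theorem dotProduct_gram_mulVec {d : ℕ} (l : ℝ) (x : ℕ → EuclideanSpace ℝ (Fin d)) (t : ℕ)
    (y : Fin d → ℝ) : y ⬝ᵥ (gram l x t *ᵥ y) = l * (y ⬝ᵥ y) + y ⬝ᵥ (gram 0 x t *ᵥ y) := by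
  simp [gram, Matrix.add_mulVec, Matrix.smul_mulVec]

theorem dotProduct_gram_zero_nonneg {d : ℕ} (x : ℕ → EuclideanSpace ℝ (Fin d)) (t : ℕ)
    (y : Fin d → ℝ) : 0 ≤ y ⬝ᵥ (gram 0 x t *ᵥ y) := by
  have := (posSemidef_sum_vecMulVec x t).dotProduct_mulVec_nonneg y
  simpa [gram] using this

theorem dotProduct_self_nonneg_real {d : ℕ} (y : Fin d → ℝ) : 0 ≤ y ⬝ᵥ y := by
  simpa using dotProduct_star_self_nonneg y

/-- Of the shift 4l, the noise consumes at most 3l, so regularization l survives. -/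
theorem dotProduct_gram_le_reg {P : Params} {x : ℕ → Vec P} {z : ℕ → NoiseIdx P → ℝ} {t : ℕ}
    {l : ℝ} (hN : ∀ w : Vec P, ‖WithLp.toLp 2 (noiseSum P z t *ᵥ w.ofLp)‖ ≤ 3 * l * ‖w‖)
    (y : Fin P.d → ℝ) :
    y ⬝ᵥ (gram l x t *ᵥ y) ≤ y ⬝ᵥ ((gram (4 * l) x t + noiseSum P z t) *ᵥ y) := by
  have h1 : |y ⬝ᵥ (noiseSum P z t *ᵥ y)| ≤ 3 * l * (y ⬝ᵥ y) := by
    have h2 := abs_real_inner_le_norm (WithLp.toLp 2 y : Vec P)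
      (WithLp.toLp 2 (noiseSum P z t *ᵥ y))
    rw [inner_eq_dotProduct] at h2
    refine h2.trans ?_
    have h3 := hN (WithLp.toLp 2 y)
    have h4 : y ⬝ᵥ y = ‖(WithLp.toLp 2 y : Vec P)‖ ^ 2 := by
      rw [← real_inner_self_eq_norm_sq, inner_eq_dotProduct]
    rw [h4]
    calc _ ≤ ‖(WithLp.toLp 2 y : Vec P)‖ * (3 * l * ‖(WithLp.toLp 2 y : Vec P)‖) := by
          gcongr
      _ = _ := by ring
  rw [Matrix.add_mulVec, dotProduct_add, dotProduct_gram_mulVec l, dotProduct_gram_mulVec (4 * l)]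
  linarith [(abs_le.1 h1).1]

theorem posDef_reg {P : Params} {x : ℕ → Vec P} {z : ℕ → NoiseIdx P → ℝ} {t : ℕ}
    {l : ℝ} (hl : 0 < l)
    (hN : ∀ w : Vec P, ‖WithLp.toLp 2 (noiseSum P z t *ᵥ w.ofLp)‖ ≤ 3 * l * ‖w‖) :
    (gram (4 * l) x t + noiseSum P z t).PosDef := by
  refine Matrix.PosDef.of_dotProduct_mulVec_pos ((posDef_gram (by positivity) x t).1.add ?_)
    fun y hy => ?_
  · rw [Matrix.IsHermitian, Matrix.conjTranspose_eq_transpose_of_trivial]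
    exact isSymm_noiseSum P z t
  · have h1 := (posDef_gram hl x t).dotProduct_mulVec_pos hy
    simp only [star_trivial] at h1 ⊢
    exact h1.trans_le (dotProduct_gram_le_reg hN y)

/-- The accumulated reward noise `∑ η x`. -/
def rewardNoise (P : Params) (x : ℕ → Vec P) (η : ℕ → ℝ) (t : ℕ) : Vec P :=
  ∑ s ∈ Finset.range t, η s • x s

/-- The accumulated vector noise `∑ ξ`. -/
def vectorNoise (P : Params) (z : ℕ → NoiseIdx P → ℝ) (t : ℕ) : Vec P :=
  ∑ s ∈ Finset.range t, WithLp.toLp 2 (noiseVector P (z s))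

/-- The residual `u - (V + c I) θ` of the regularized least squares problem. -/
def residual (P : Params) (θ : Vec P) (x : ℕ → Vec P) (η : ℕ → ℝ) (z : ℕ → NoiseIdx P → ℝ)
    (c : ℝ) (t : ℕ) : Vec P :=
  rewardNoise P x η t + vectorNoise P z t
    - (WithLp.toLp 2 (noiseSum P z t *ᵥ θ.ofLp) + c • θ)

theorem serverVector_eq (P : Params) (θ : Vec P) (x : ℕ → Vec P) (η : ℕ → ℝ)
    (z : ℕ → NoiseIdx P → ℝ) (c : ℝ) (t : ℕ) :
    serverVector P θ x η z t = (gram c x t + noiseSum P z t) *ᵥ θ.ofLp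
      + (residual P θ x η z c t).ofLp := by
  have h1 : serverVector P θ x η z t = gram 0 x t *ᵥ θ.ofLp + (rewardNoise P x η t).ofLp
      + (vectorNoise P z t).ofLp := by
    simp only [serverVector, reward, gram, rewardNoise, vectorNoise, zero_smul, zero_add,
      Matrix.sum_mulVec, WithLp.ofLp_sum, WithLp.ofLp_smul, ← Finset.sum_add_distrib]
    refine Finset.sum_congr rfl fun s _ => ?_
    rw [Matrix.vecMulVec_mulVec, inner_eq_dotProduct, add_smul]
    simp
  rw [h1, residual]
  simp only [gram, Matrix.add_mulVec, Matrix.smul_mulVec, Matrix.one_mulVec, WithLp.ofLp_sub,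
    WithLp.ofLp_add, WithLp.ofLp_smul, zero_smul, zero_add]
  abel

/-- The error is vᵀH⁻¹ applied to the residual. Cauchy-Schwarz in the H⁻¹-form splits off the norm
of v, and H ≥ l I bounds the squared norm of the residual by its Euclidean square divided by l. -/
theorem abs_inner_estimator_sub_le {P : Params} {θ : Vec P} {x : ℕ → Vec P} {η : ℕ → ℝ}
    {z : ℕ → NoiseIdx P → ℝ} {t : ℕ} {l ρ : ℝ} (hl : 0 < l) (hc : shift P t = 4 * l)
    (hN : ∀ w : Vec P, ‖WithLp.toLp 2 (noiseSum P z t *ᵥ w.ofLp)‖ ≤ 3 * l * ‖w‖)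
    (hρ : 0 ≤ ρ) (hr : ‖residual P θ x η z (4 * l) t‖ ^ 2 ≤ ρ ^ 2 * l) (v : Vec P) :
    |inner ℝ (estimator P θ x η z t) v - inner ℝ v θ| ≤ ρ * matNorm P (regInv P x z t) v := by
  have hH := posDef_reg (x := x) hl hN
  set H := gram (4 * l) x t + noiseSum P z t with hHdef
  have hreg : regInv P x z t = H⁻¹ := by rw [regInv, serverMatrix_add_smul, hc]
  have hdiff : inner ℝ (estimator P θ x η z t) v - inner ℝ v θ
      = v.ofLp ⬝ᵥ (H⁻¹ *ᵥ (residual P θ x η z (4 * l) t).ofLp) := by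
    rw [real_inner_comm, inner_eq_dotProduct, inner_eq_dotProduct, estimator, hreg,
      serverVector_eq P θ x η z (4 * l), ← hHdef, Matrix.mulVec_add, Matrix.mulVec_mulVec,
      Matrix.nonsing_inv_mul _ ((Matrix.isUnit_iff_isUnit_det _).1 hH.isUnit), Matrix.one_mulVec,
      dotProduct_add]
    ring
  rw [hdiff, hreg, matNorm, mul_comm ρ]
  refine (abs_dotProduct_mulVec_le hH.inv.posSemidef _ _).trans ?_
  gcongr
  refine Real.sqrt_le_left hρ |>.2 ?_
  refine (dotProduct_inv_mulVec_le_div hH hl (fun y => ?_) _).trans ?_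
  · refine le_trans ?_ (dotProduct_gram_le_reg hN y)
    rw [dotProduct_gram_mulVec]
    linarith [dotProduct_gram_zero_nonneg x t y]
  · rw [div_le_iff₀ hl, ← inner_eq_dotProduct, real_inner_self_eq_norm_sq]
    exact hr

/-- Replaces the regularization of round t by a smaller `l₁`, which can be common to all rounds as
the potential lemma requires. -/
theorem matNorm_regInv_le {P : Params} {x : ℕ → Vec P}
    {z : ℕ → NoiseIdx P → ℝ} {t : ℕ} {l l₁ : ℝ} (hl₁ : 0 < l₁) (hl : l₁ ≤ l)
    (hc : shift P t = 4 * l)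
    (hN : ∀ w : Vec P, ‖WithLp.toLp 2 (noiseSum P z t *ᵥ w.ofLp)‖ ≤ 3 * l * ‖w‖) (v : Vec P) :
    matNorm P (regInv P x z t) v ≤ √(v.ofLp ⬝ᵥ ((gram l₁ x t)⁻¹ *ᵥ v.ofLp)) := by
  rw [matNorm, regInv, serverMatrix_add_smul, hc]
  refine Real.sqrt_le_sqrt (dotProduct_inv_mulVec_le (posDef_reg (hl₁.trans_le hl) hN)
    (posDef_gram hl₁ x t) (fun y => le_trans ?_ (dotProduct_gram_le_reg hN y)) _)
  rw [dotProduct_gram_mulVec l₁, dotProduct_gram_mulVec l]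
  have := dotProduct_self_nonneg_real y
  gcongr

/-! ### Optimism and summation over rounds -/

/-- The regret of an optimistic choice. -/
theorem regret_le_of_isMaxOn {P : Params} {θ : Vec P} {x : ℕ → Vec P} {η : ℕ → ℝ}
    {z : ℕ → NoiseIdx P → ℝ} {t : ℕ} {D : Set (Vec P)} {a b : Vec P} {ρ : ℝ}
    (hmax : IsMaxOn (ucb P θ x η z t) D a) (hb : b ∈ D) (hβ : ρ ≤ beta P (t + 1))
    (h : ∀ v, |inner ℝ (estimator P θ x η z t) v - inner ℝ v θ|
      ≤ ρ * matNorm P (regInv P x z t) v) :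
    inner ℝ b θ - inner ℝ a θ ≤ 2 * beta P (t + 1) * matNorm P (regInv P x z t) a := by
  have h1 : ucb P θ x η z t b ≤ ucb P θ x η z t a := hmax hb
  rw [ucb, ucb] at h1
  have hm : ∀ v, 0 ≤ matNorm P (regInv P x z t) v := fun v => Real.sqrt_nonneg _
  have h2 := (abs_le.1 (h b)).1
  have h3 := (abs_le.1 (h a)).2
  have h4 := mul_le_mul_of_nonneg_right hβ (hm a)
  have h5 := mul_le_mul_of_nonneg_right hβ (hm b)
  linarith

theorem inner_sub_inner_le_two {P : Params} {θ a b : Vec P} (hθ : ‖θ‖ ≤ 1) (ha : ‖a‖ ≤ 1)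
    (hb : ‖b‖ ≤ 1) : inner ℝ b θ - inner ℝ a θ ≤ 2 := by
  have h1 : ∀ v : Vec P, ‖v‖ ≤ 1 → |inner ℝ v θ| ≤ 1 := fun v hv =>
    (abs_real_inner_le_norm _ _).trans (mul_le_one₀ hv (norm_nonneg _) hθ)
  linarith [(abs_le.1 (h1 b hb)).2, (abs_le.1 (h1 a ha)).1]

/-- Summing optimistic regrets by the elliptical potential lemma. -/
theorem sum_le_of_le_min {d T : ℕ} {l B : ℝ} (hl : 0 < l) (hB : 1 ≤ B)
    {x : ℕ → EuclideanSpace ℝ (Fin d)} (hx : ∀ s < T, ‖x s‖ ≤ 1) {f : ℕ → ℝ}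
    (hf : ∀ t < T, f t ≤ 2)
    (hf' : ∀ t, 1 ≤ t → t < T → f t ≤ 2 * B * √((x t).ofLp ⬝ᵥ ((gram l x t)⁻¹ *ᵥ (x t).ofLp))) :
    ∑ t ∈ Finset.range T, f t ≤ 2 * B * (1 + √(T * (2 * (d * Real.log (1 + T / l))))) := by
  set u : ℕ → ℝ := fun t => (x t).ofLp ⬝ᵥ ((gram l x t)⁻¹ *ᵥ (x t).ofLp) with hu
  have hnn : ∀ s, 0 ≤ min 1 (u s) := fun s => le_min zero_le_one (by
    simpa using (posDef_gram hl x s).inv.posSemidef.dotProduct_mulVec_nonneg (x s).ofLp)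
  -- Round 0 is charged the trivial 2 ≤ 2B. In later rounds the trivial bound also permits
  -- truncating the potential at 1.
  have hterm : ∀ t ∈ Finset.range T, f t ≤ (if t = 0 then 2 * B else 0) + 2 * B * √(min 1 (u t)) := by
    intro t ht
    have htT := Finset.mem_range.1 ht
    have hs := Real.sqrt_nonneg (min 1 (u t))
    split_ifs with h0
    · have := hf t htT
      have : 0 ≤ 2 * B * √(min 1 (u t)) := by positivity
      linarith
    · rw [zero_add]
      rcases le_total 1 (u t) with h1 | h1
      · rw [min_eq_left h1, Real.sqrt_one]
        linarith [hf t htT]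
      · rw [min_eq_right h1]
        exact hf' t (Nat.one_le_iff_ne_zero.2 h0) htT
  have hcs : ∑ t ∈ Finset.range T, √(min 1 (u t)) ≤ √(T * (2 * (d * Real.log (1 + T / l)))) := by
    refine Real.le_sqrt_of_sq_le (sq_sum_le_card_mul_sum_sq.trans ?_)
    rw [Finset.card_range]
    gcongr
    simp_rw [Real.sq_sqrt (hnn _)]
    exact sum_min_le_log hl hx
  calc _ ≤ ∑ t ∈ Finset.range T, ((if t = 0 then 2 * B else 0) + 2 * B * √(min 1 (u t))) :=
        Finset.sum_le_sum hterm
    _ ≤ 2 * B + 2 * B * ∑ t ∈ Finset.range T, √(min 1 (u t)) := by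
        rw [Finset.sum_add_distrib, ← Finset.mul_sum, Finset.sum_ite_eq']
        gcongr
        split_ifs <;> linarith
    _ ≤ 2 * B + 2 * B * √(T * (2 * (d * Real.log (1 + T / l)))) := by gcongr
    _ = _ := by ring

/-- The noise bounds on a net give bounds on the noises themselves. -/
theorem noise_le_of_net {P : Params} {x : ℕ → Vec P} {η : ℕ → ℝ} {z : ℕ → NoiseIdx P → ℝ} {t : ℕ}
    {s : Finset (Vec P)} (hs : IsSphereNet s) {r₁ r₂ r₃ : ℝ} (h₁ : 0 ≤ r₁) (h₂ : 0 ≤ r₂)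
    (h₃ : 0 ≤ r₃)
    (h : ∀ v ∈ s,
        |∑ i ∈ Finset.range t, v.ofLp ⬝ᵥ (noiseMatrix P (z i) *ᵥ v.ofLp)| ≤ r₁ ∧
        ∑ i ∈ Finset.range t, v.ofLp ⬝ᵥ noiseVector P (z i) ≤ r₂ ∧
        ∑ i ∈ Finset.range t, η i * inner ℝ v (x i) ≤ r₃) :
    (∀ w : Vec P, ‖WithLp.toLp 2 (noiseSum P z t *ᵥ w.ofLp)‖ ≤ 2 * r₁ * ‖w‖) ∧
      ‖vectorNoise P z t‖ ≤ 2 * r₂ ∧ ‖rewardNoise P x η t‖ ≤ 2 * r₃ := by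
  refine ⟨hs.norm_mulVec_le (isSymm_noiseSum P z t) h₁ fun v hv => ?_,
    hs.norm_le h₂ fun v hv => ?_, hs.norm_le h₃ fun v hv => ?_⟩
  · rw [noiseSum, Matrix.sum_mulVec, dotProduct_sum]
    exact (h v hv).1
  · rw [vectorNoise, inner_sum]
    simpa only [inner_eq_dotProduct] using (h v hv).2.1
  · rw [rewardNoise, inner_sum]
    simpa only [real_inner_smul_right] using (h v hv).2.2

/-! ### Sizes of the noise level and the radius -/

/-- Since log 2.5 ≥ 1 - 1/2.5 ≥ 1/2, the square root in `sigma` is at least 1. The inequality serves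
to insert missing factors σ. -/
theorem one_le_sigma_mul {P : Params} {ε₀ : ℝ} (hε : 0 < P.ε) (hε₀ : P.ε ≤ ε₀) (hδ : 0 < P.δ)
    (hδ1 : P.δ ≤ 1) : 1 ≤ sigma P * ε₀ := by
  have h1 : (1 : ℝ) / 2 ≤ Real.log (2.5 / P.δ) := by
    have h2 : (2.5 : ℝ) ≤ 2.5 / P.δ := by
      rw [le_div_iff₀ hδ]
      linarith
    have h3 := Real.one_sub_inv_le_log_of_pos (show (0 : ℝ) < 2.5 by norm_num)
    have h4 := Real.log_le_log (by norm_num) h2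
    norm_num at h3
    linarith
  have h2 : 1 ≤ √(2 * Real.log (2.5 / P.δ)) := Real.one_le_sqrt.2 (by linarith)
  rw [sigma, div_mul_eq_mul_div, le_div_iff₀ hε]
  nlinarith

theorem sigma_le {P : Params} {q : ℝ} (hq : 0 < q) (hε : 0 < P.ε) (hδ : 0 < P.δ)
    (hqδ : q ≤ Real.log (1 / P.δ)) :
    sigma P ≤ 6 * √(2 * (1 / q + 1)) * (√(Real.log (1 / P.δ)) / P.ε) := by
  have h1 : Real.log (2.5 / P.δ) ≤ (1 / q + 1) * Real.log (1 / P.δ) := by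
    have h2 : Real.log (2.5 / P.δ) = Real.log 2.5 + Real.log (1 / P.δ) := by
      rw [← Real.log_mul (by norm_num) (by positivity)]
      congr 1
      ring
    have h3 : Real.log 2.5 ≤ 1 := by
      rw [Real.log_le_iff_le_exp (by norm_num)]
      linarith [Real.exp_one_gt_d9]
    have h4 : 1 ≤ 1 / q * Real.log (1 / P.δ) := by
      rw [one_div, inv_mul_eq_div]
      exact (one_le_div₀ hq).2 hqδ
    linarith
  rw [sigma, mul_div_assoc', mul_assoc, ← Real.sqrt_mul (by positivity)]
  have h2 : √(2 * Real.log (2.5 / P.δ)) ≤ √(2 * (1 / q + 1) * Real.log (1 / P.δ)) :=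
    Real.sqrt_le_sqrt (by linarith)
  gcongr

theorem upsilon_mono {P : Params} (hσ : 0 < sigma P) (hL : 0 ≤ Real.log (2 * P.T / P.α)) {s t : ℕ}
    (hst : s ≤ t) : upsilon P s ≤ upsilon P t := by
  rw [upsilon, upsilon]
  gcongr

theorem upsilon_pos {P : Params} (hσ : 0 < sigma P) (hL : 0 < Real.log (2 * P.T / P.α)) {t : ℕ}
    (ht : 1 ≤ t) : 0 < upsilon P t := by
  have : (0 : ℝ) < t := by exact_mod_cast ht
  rw [upsilon]
  positivity

/-- The one summand of the radius that optimism needs; `κ ≥ 1` only enlarges it. -/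
theorem sqrt_log_le_beta {P : Params} (hσ : 0 < sigma P) (hL : 0 ≤ Real.log (2 * P.T / P.α))
    (hκ : 1 ≤ P.κ) (t : ℕ) :
    √(3 * upsilon P t) * Real.log P.T ≤ beta P (t + 1) := by
  have h0 := Real.log_natCast_nonneg P.T
  have h1 : √(3 * upsilon P t) ≤ √(3 * upsilon P (t + 1)) := by
    gcongr
    exact upsilon_mono hσ hL (Nat.le_succ t)
  rw [beta]
  have h2 : Real.log P.T ≤ P.κ * Real.log P.T := le_mul_of_one_le_left h0 hκ
  calc √(3 * upsilon P t) * Real.log P.T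
      ≤ √(3 * upsilon P (t + 1)) * (P.κ * Real.log P.T) := by gcongr
    _ ≤ (√(3 * upsilon P (t + 1)) + sigma P * √(P.d * (t + 1 : ℕ) / upsilon P (t + 1)))
        * (P.κ * Real.log P.T) := by
        gcongr
        exact le_add_of_nonneg_right (by positivity)
    _ ≤ _ := le_add_of_nonneg_left (by positivity)

/-! ### Regret on the good event -/

/-- The regret on the event that all accumulated noises are controlled. -/
theorem regret_le_of_noise {P : Params} {θ : Vec P} {x xs : ℕ → Vec P} {η : ℕ → ℝ}
    {z : ℕ → NoiseIdx P → ℝ} {D : ℕ → Set (Vec P)} {ε₀ B r : ℝ} (hσ : 0 < sigma P)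
    (hε₀ : 0 ≤ ε₀)
    (hσε : 1 ≤ sigma P * ε₀) (hκ : 1 ≤ P.κ) (hT : 5 + 2 * ε₀ ≤ Real.log P.T)
    (hL : 3 ≤ Real.log (2 * P.T / P.α))
    (hr : r ≤ 2 * P.d + (Real.log (2 * P.T / P.α) + 1)) (hB : 1 ≤ B)
    (hβ : ∀ t, 1 ≤ t → t ≤ P.T → beta P t ≤ B) (hθ : ‖θ‖ ≤ 1)
    (hD : ∀ t < P.T, ∀ v ∈ D t, ‖v‖ ≤ 1) (hx : ∀ t < P.T, x t ∈ D t) (hxs : ∀ t < P.T, xs t ∈ D t)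
    (hmax : ∀ t < P.T, IsMaxOn (ucb P θ x η z t) (D t) (x t))
    {s : Finset (Vec P)} (hs : IsSphereNet s)
    (hgood : ∀ t, 1 ≤ t → t < P.T → ∀ v ∈ s,
        |∑ i ∈ Finset.range t, v.ofLp ⬝ᵥ (noiseMatrix P (z i) *ᵥ v.ofLp)|
          ≤ 2 * sigma P * √t * √r ∧
        ∑ i ∈ Finset.range t, v.ofLp ⬝ᵥ noiseVector P (z i) ≤ 2 * sigma P * √t * √r ∧
        ∑ i ∈ Finset.range t, η i * inner ℝ v (x i) ≤ 2 * √t * √r) :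
    regret P θ x xs ≤
      2 * B * (1 + √(P.T * (2 * (P.d * Real.log (1 + P.T / (upsilon P 1 / 2)))))) := by
  have hL0 : 0 < Real.log (2 * P.T / P.α) := by linarith
  set L := Real.log (2 * P.T / P.α) with hLdef
  -- The right side is 3/2 of the bracket in `upsilon`. After squaring, the term 9L²/16 absorbs L +
  -- 1 because L ≥ 3.
  have hsq : 4 * √r ≤ 6 * √P.d + 3 * L := by
    have h1 : √r ≤ (6 * √P.d + 3 * L) / 4 := by
      refine Real.sqrt_le_left (by positivity) |>.2 (hr.trans ?_)
      have h2 := Real.sq_sqrt (Nat.cast_nonneg (α := ℝ) P.d)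
      have h3 := Real.sqrt_nonneg (P.d : ℝ)
      nlinarith [mul_nonneg h3 hL0.le]
    linarith
  have hl₁ : 0 < upsilon P 1 / 2 := half_pos (upsilon_pos hσ hL0 le_rfl)
  refine sum_le_of_le_min hl₁ hB (fun t ht => hD t ht _ (hx t ht))
    (fun t ht => inner_sub_inner_le_two hθ (hD t ht _ (hx t ht)) (hD t ht _ (hxs t ht)))
    fun t ht1 htT => ?_
  have hΥ := upsilon_pos hσ hL0 ht1
  have hbound : 2 * (2 * sigma P * √t * √r) ≤ 3 / 2 * upsilon P t := by
    rw [upsilon, ← hLdef]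
    calc _ = sigma P * √t * (4 * √r) := by ring
      _ ≤ sigma P * √t * (6 * √P.d + 3 * L) := by gcongr
      _ = _ := by ring
  have hbound' : 2 * (2 * √t * √r) ≤ 3 / 2 * upsilon P t * ε₀ := by
    calc 2 * (2 * √t * √r) ≤ 2 * (2 * √t * √r) * (sigma P * ε₀) :=
          le_mul_of_one_le_right (by positivity) hσε
      _ = 2 * (2 * sigma P * √t * √r) * ε₀ := by ring
      _ ≤ _ := by gcongr
  obtain ⟨hN, hΞ, hS⟩ := noise_le_of_net hs (by positivity) (by positivity) (by positivity)
    (hgood t ht1 htT)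
  -- The choice l = Υ/2: the shift is 4l and the noise bound 3Υ/2 is 3l.
  have hc : shift P t = 4 * (upsilon P t / 2) := by rw [shift]; ring
  have hN' : ∀ w : Vec P, ‖WithLp.toLp 2 (noiseSum P z t *ᵥ w.ofLp)‖
      ≤ 3 * (upsilon P t / 2) * ‖w‖ := fun w =>
    (hN w).trans (mul_le_mul_of_nonneg_right (by linarith) (norm_nonneg _))
  have hlog : 0 ≤ Real.log P.T := Real.log_natCast_nonneg _
  -- The four contributions add up to (5 + 3ε₀/2)Υ, which explains the threshold on ln T.
  have hres : ‖residual P θ x η z (4 * (upsilon P t / 2)) t‖ ≤ upsilon P t * Real.log P.T := by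
    have h1 : ‖residual P θ x η z (4 * (upsilon P t / 2)) t‖ ≤
        3 / 2 * upsilon P t * ε₀ + 3 / 2 * upsilon P t + (3 * (upsilon P t / 2) * 1
          + 4 * (upsilon P t / 2) * 1) := by
      rw [residual]
      refine (norm_sub_le _ _).trans (add_le_add ((norm_add_le _ _).trans
        (add_le_add (hS.trans hbound') (hΞ.trans hbound))) ((norm_add_le _ _).trans
        (add_le_add ((hN' θ).trans (by gcongr)) ?_)))
      rw [norm_smul, Real.norm_of_nonneg (by positivity)]
      gcongr
    have h2 := mul_le_mul_of_nonneg_left hT hΥ.le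
    nlinarith [mul_nonneg hΥ.le hε₀]
  have hest := abs_inner_estimator_sub_le (θ := θ) (x := x) (η := η) (z := z) (half_pos hΥ) hc hN'
    (ρ := √(3 * upsilon P t) * Real.log P.T) (by positivity) (by
      rw [mul_pow, Real.sq_sqrt (by positivity)]
      calc _ ≤ (upsilon P t * Real.log P.T) ^ 2 := by gcongr
        _ ≤ _ := by nlinarith [sq_nonneg (upsilon P t * Real.log P.T)])
  have hreg := regret_le_of_isMaxOn (hmax t htT) (hxs t htT) (sqrt_log_le_beta hσ hL0.le hκ t) hest
  refine hreg.trans ?_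
  have hm := matNorm_regInv_le (x := x) hl₁ (l := upsilon P t / 2)
    (by have := upsilon_mono hσ hL0.le ht1; linarith) hc hN' (x t)
  have hm0 : 0 ≤ matNorm P (regInv P x z t) (x t) := Real.sqrt_nonneg _
  have hb := hβ (t + 1) (by omega) htT
  gcongr

/-! ### Bounds in powers of (dT)^(1/4) -/

/-- The constant in the bound on the confidence radius. -/
noncomputable def betaConst (ε₀ q : ℝ) : ℝ := (2 + √ε₀ + ε₀) / √q + √(3 * (6 / q + 2) * ε₀)

/-- With y = (dT)^(1/4): √d ≤ y because d ≤ T; √Υ is of order √σ y and √σ ≤ σ√ε₀; and Υ ≥ 4σ√(dt)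
controls dt/Υ. Terms without √(ln(1/α)) acquire it at the cost 1/√q. -/
theorem beta_le {P : Params} {ε₀ q : ℝ} (hq : 0 < q) (hε₀ : 0 < ε₀) (hσ : 0 < sigma P)
    (hσε : 1 ≤ sigma P * ε₀) (hκ : 1 ≤ P.κ) (hα : 0 < P.α) (hqα : q ≤ Real.log (1 / P.α))
    (hd : 1 ≤ P.d) (hdT : P.d ≤ P.T) {y : ℝ} (hy : 1 ≤ y) (hyT : y ^ 4 = P.d * P.T) {t : ℕ}
    (ht1 : 1 ≤ t) (htT : t ≤ P.T) :
    beta P t ≤ sigma P * y * P.κ * (1 + Real.log P.T) ^ 2 * √(Real.log (1 / P.α))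
      * betaConst ε₀ q := by
  have hT1 : 1 ≤ P.T := hd.trans hdT
  have hTpos : (0 : ℝ) < P.T := by exact_mod_cast hT1
  have hd1 : (1 : ℝ) ≤ P.d := by exact_mod_cast hd
  have htpos : (0 : ℝ) < t := by exact_mod_cast ht1
  have hlog : 0 ≤ Real.log P.T := Real.log_natCast_nonneg _
  set b := Real.log (1 / P.α) with hb
  set ℓ := 1 + Real.log P.T with hℓ
  have hℓ1 : 1 ≤ ℓ := by linarith
  have hb0 : 0 < b := hq.trans_le hqα
  have hsd : √P.d * √P.T = y ^ 2 := by
    rw [← Real.sqrt_mul (by positivity), ← hyT, show y ^ 4 = (y ^ 2) ^ 2 by ring,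
      Real.sqrt_sq (by positivity)]
  have hsd1 : 1 ≤ √P.d := Real.one_le_sqrt.2 hd1
  have hL : Real.log (2 * P.T / P.α) = Real.log 2 + Real.log P.T + b := by
    rw [hb, ← Real.log_mul two_ne_zero hTpos.ne', ← Real.log_mul (by positivity) (by positivity)]
    congr 1
    ring
  have hlog2 : Real.log 2 ≤ 1 := by linarith [Real.log_two_lt_d9]
  have hlog20 : 0 ≤ Real.log 2 := Real.log_nonneg one_le_two
  have hbq : 1 ≤ √b / √q := (one_le_div₀ (Real.sqrt_pos.2 hq)).2 (Real.sqrt_le_sqrt hqα)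
  have hbq' : 1 ≤ b / q := (one_le_div₀ hq).2 hqα
  have hℓℓ : ℓ ≤ ℓ ^ 2 := le_self_pow₀ hℓ1 two_ne_zero
  have hsℓ : √ℓ ≤ ℓ := Real.sqrt_le_left (by positivity) |>.2 hℓℓ
  have e1 : √(P.d * Real.log P.T) ≤ y * ℓ := by
    rw [Real.sqrt_mul (by positivity)]
    have h1 : √P.d ≤ y := by
      refine Real.sqrt_le_left (by positivity) |>.2 ?_
      have h2 : (P.d : ℝ) ≤ P.T := by exact_mod_cast hdT
      refine abs_le_of_sq_le_sq' ?_ (by positivity) |>.2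
      calc (P.d : ℝ) ^ 2 ≤ P.d * P.T := by rw [sq]; gcongr
        _ = _ := by rw [← hyT]; ring
    have h2 : √(Real.log P.T) ≤ ℓ := (Real.sqrt_le_sqrt (by linarith)).trans hsℓ
    gcongr
  have hΥ : upsilon P t ≤ sigma P * (y ^ 2 * (ℓ * b * (6 / q + 2))) := by
    rw [upsilon, mul_assoc, hL]
    refine mul_le_mul_of_nonneg_left ?_ hσ.le
    calc √t * (4 * √P.d + 2 * (Real.log 2 + Real.log P.T + b))
        ≤ √P.T * (√P.d * (4 * (ℓ * (b / q)) + 2 * (ℓ * (b / q) + ℓ * b))) := by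
          gcongr
          rw [mul_add]
          have h1 : 1 ≤ ℓ * (b / q) := one_le_mul_of_one_le_of_one_le hℓ1 hbq'
          have h2 : ℓ ≤ ℓ * (b / q) := le_mul_of_one_le_right (by positivity) hbq'
          have h3 : b ≤ ℓ * b := le_mul_of_one_le_left hb0.le hℓ1
          have h4 : 4 * √P.d ≤ √P.d * (4 * (ℓ * (b / q))) := by
            rw [mul_comm]; gcongr; linarith
          have h5 : 2 * (Real.log 2 + Real.log P.T + b) ≤ 2 * (ℓ * (b / q) + ℓ * b) := by linarith
          have h6 : 2 * (ℓ * (b / q) + ℓ * b) ≤ √P.d * (2 * (ℓ * (b / q) + ℓ * b)) :=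
            le_mul_of_one_le_left (by positivity) hsd1
          linarith
      _ = (√P.d * √P.T) * (ℓ * b * (6 / q + 2)) := by ring
      _ = _ := by rw [hsd]
  have hΥ' : 4 * (sigma P * (√P.d * √t)) ≤ upsilon P t := by
    rw [upsilon, hL]
    calc _ = sigma P * √t * (4 * √P.d) := by ring
      _ ≤ _ := by
        gcongr
        exact le_add_of_nonneg_right (by positivity)
  have hσσ : sigma P ≤ sigma P ^ 2 * ε₀ := by
    calc sigma P ≤ sigma P * (sigma P * ε₀) := le_mul_of_one_le_right hσ.le hσε
      _ = _ := by ring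
  have e2 : √(3 * upsilon P t) ≤ sigma P * y * ℓ * √b * √(3 * (6 / q + 2) * ε₀) := by
    refine Real.sqrt_le_left (by positivity) |>.2 ?_
    rw [mul_pow, mul_pow, mul_pow, mul_pow, Real.sq_sqrt hb0.le, Real.sq_sqrt (by positivity)]
    calc 3 * upsilon P t ≤ 3 * (sigma P * (y ^ 2 * (ℓ * b * (6 / q + 2)))) := by gcongr
      _ ≤ 3 * ((sigma P ^ 2 * ε₀) * (y ^ 2 * (ℓ ^ 2 * b * (6 / q + 2)))) := by
          gcongr
      _ = _ := by ring
  have e3 : √(P.d * t / upsilon P t) ≤ y * √ε₀ := by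
    refine Real.sqrt_le_left (by positivity) |>.2 ?_
    have hpos : 0 < sigma P * (√P.d * √t) := by positivity
    rw [mul_pow, Real.sq_sqrt hε₀.le, div_le_iff₀ (by linarith)]
    have h1 : (√P.d * √t) ^ 2 = P.d * t := by
      rw [mul_pow, Real.sq_sqrt (by positivity), Real.sq_sqrt (by positivity)]
    have h2 : √P.d * √t ≤ y ^ 2 := by
      rw [← hsd]
      gcongr
    have h3 : √P.d * √t ≤ (sigma P * ε₀) * (√P.d * √t) :=
      le_mul_of_one_le_left (by positivity) hσε
    rw [← h1]
    calc (√P.d * √t) ^ 2 ≤ y ^ 2 * ((sigma P * ε₀) * (√P.d * √t)) := by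
          rw [sq]; gcongr
      _ = y ^ 2 * ε₀ * (sigma P * (√P.d * √t)) := by ring
      _ ≤ _ := by gcongr; linarith
  have hκℓ : 1 ≤ P.κ * ℓ := one_le_mul_of_one_le_of_one_le hκ hℓ1
  have hbase : 0 ≤ sigma P * y * P.κ * ℓ ^ 2 := by positivity
  rw [beta, betaConst]
  calc _ ≤ 2 * sigma P * (y * ℓ) + (sigma P * y * ℓ * √b * √(3 * (6 / q + 2) * ε₀)
          + sigma P * (y * √ε₀)) * (P.κ * ℓ) := by
        gcongr
        linarith
    _ ≤ 2 * (sigma P * y * P.κ * ℓ ^ 2 * (√b / √q))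
        + (sigma P * y * P.κ * ℓ ^ 2 * √b * √(3 * (6 / q + 2) * ε₀)
          + sigma P * y * P.κ * ℓ ^ 2 * (√b / √q) * √ε₀) := by
        have h1 : sigma P * y * ℓ ≤ sigma P * y * P.κ * ℓ ^ 2 := by
          calc sigma P * y * ℓ ≤ sigma P * y * ℓ * (P.κ * ℓ) :=
                le_mul_of_one_le_right (by positivity) hκℓ
            _ = _ := by ring
        have h2 := le_mul_of_one_le_right hbase hbq
        have h3 : sigma P * y * P.κ * ℓ ≤ sigma P * y * P.κ * ℓ ^ 2 := by
          gcongr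
        have h4 := mul_le_mul_of_nonneg_right (h3.trans h2) (Real.sqrt_nonneg ε₀)
        have h5 : 2 * sigma P * (y * ℓ) ≤ 2 * (sigma P * y * P.κ * ℓ ^ 2 * (√b / √q)) := by
          rw [mul_assoc, ← mul_assoc (sigma P)]
          exact mul_le_mul_of_nonneg_left (h1.trans h2) zero_le_two
        rw [add_mul]
        refine add_le_add h5 (add_le_add (le_of_eq ?_) ((le_of_eq ?_).trans h4)) <;> ring
    -- The added multiple of `ε₀` is slack: it makes the final bound at least 1, as
    -- `one_le_betaBound` needs.
    _ ≤ 2 * (sigma P * y * P.κ * ℓ ^ 2 * (√b / √q))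
        + (sigma P * y * P.κ * ℓ ^ 2 * √b * √(3 * (6 / q + 2) * ε₀)
          + sigma P * y * P.κ * ℓ ^ 2 * (√b / √q) * √ε₀)
        + sigma P * y * P.κ * ℓ ^ 2 * (√b / √q) * ε₀ := le_add_of_nonneg_right (by positivity)
    _ = _ := by ring

theorem one_le_betaBound {σ y κ ℓ b ε₀ q : ℝ} (hq : 0 < q) (hε₀ : 0 < ε₀) (hσ : 0 < σ)
    (hσε : 1 ≤ σ * ε₀) (hκ : 1 ≤ κ) (hqα : q ≤ b) (hy : 1 ≤ y) (hℓ : 1 ≤ ℓ) :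
    1 ≤ σ * y * κ * ℓ ^ 2 * √b * betaConst ε₀ q := by
  have hbq : 1 ≤ √b / √q := (one_le_div₀ (Real.sqrt_pos.2 hq)).2 (Real.sqrt_le_sqrt hqα)
  have h1 : ε₀ / √q ≤ betaConst ε₀ q := by
    rw [betaConst]
    refine le_add_of_le_of_nonneg ?_ (Real.sqrt_nonneg _)
    gcongr
    exact le_add_of_nonneg_left (by positivity)
  calc (1 : ℝ) ≤ (σ * ε₀) * (√b / √q) * (y * κ * ℓ ^ 2) :=
        one_le_mul_of_one_le_of_one_le (one_le_mul_of_one_le_of_one_le hσε hbq)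
          (one_le_mul_of_one_le_of_one_le (one_le_mul_of_one_le_of_one_le hy hκ)
            (one_le_pow₀ hℓ))
    _ = σ * y * κ * ℓ ^ 2 * √b * (ε₀ / √q) := by ring
    _ ≤ _ := by gcongr

/-- The bound for long horizons, in terms of `y = (d T) ^ (1 / 4)`. -/
theorem two_mul_bound_le {P : Params} {ε₀ B y : ℝ} (hε₀ : 0 < ε₀) (hσ : 0 < sigma P)
    (hσε : 1 ≤ sigma P * ε₀) (hB : 0 ≤ B) (hT : 5 + 2 * ε₀ ≤ Real.log P.T)
    (hT1 : (1 : ℝ) ≤ P.T) (hL : 1 ≤ Real.log (2 * P.T / P.α))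
    (hy : 1 ≤ y) (hyT : y ^ 4 = P.d * P.T) :
    2 * B * (1 + √(P.T * (2 * (P.d * Real.log (1 + P.T / (upsilon P 1 / 2))))))
      ≤ 6 * B * y ^ 2 * (1 + Real.log P.T) := by
  set ℓ := 1 + Real.log P.T with hℓ
  have hℓ1 : 1 ≤ ℓ := by linarith
  have hΥ : sigma P ≤ upsilon P 1 / 2 := by
    rw [upsilon, Nat.cast_one, Real.sqrt_one, mul_one]
    have := Real.sqrt_nonneg (P.d : ℝ)
    nlinarith
  -- As `upsilon P 1 / 2` is at least σ ≥ 1/ε₀, the ratio is at most Tε₀; the resulting log (1 + ε₀)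
  -- ≤ ε₀ is absorbed by ln T.
  have hlog : Real.log (1 + P.T / (upsilon P 1 / 2)) ≤ 2 * ℓ := by
    have h1 : P.T / (upsilon P 1 / 2) ≤ P.T * ε₀ := by
      rw [div_le_iff₀ (by linarith)]
      calc (P.T : ℝ) ≤ P.T * (sigma P * ε₀) := le_mul_of_one_le_right (by positivity) hσε
        _ = P.T * ε₀ * sigma P := by ring
        _ ≤ _ := by gcongr
    have h0 : 0 < upsilon P 1 / 2 := by linarith
    calc _ ≤ Real.log (P.T * (1 + ε₀)) :=
          Real.log_le_log (by positivity) (by linarith)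
      _ = Real.log P.T + Real.log (1 + ε₀) := Real.log_mul (by positivity) (by positivity)
      _ ≤ Real.log P.T + ε₀ := by
          have := Real.log_le_sub_one_of_pos (show 0 < 1 + ε₀ by positivity)
          linarith
      _ ≤ 2 * ℓ := by linarith
  have hsqrt : √(P.T * (2 * (P.d * Real.log (1 + P.T / (upsilon P 1 / 2))))) ≤ 2 * (y ^ 2 * ℓ) := by
    refine Real.sqrt_le_left (by positivity) |>.2 ?_
    calc _ ≤ P.T * (2 * (P.d * (2 * ℓ))) := by gcongr
      _ = 4 * (y ^ 4 * ℓ) := by rw [hyT]; ring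
      _ ≤ 4 * (y ^ 4 * ℓ ^ 2) := by gcongr; nlinarith
      _ = _ := by ring
  have h1 : 1 ≤ y ^ 2 * ℓ := one_le_mul_of_one_le_of_one_le (one_le_pow₀ hy) hℓ1
  calc _ ≤ 2 * B * (3 * (y ^ 2 * ℓ)) := by gcongr; linarith
    _ = _ := by ring

/-- The constant of the regret bound. -/
noncomputable def regretConst (ε₀ q : ℝ) : ℝ :=
  6 * betaConst ε₀ q * (6 * √(2 * (1 / q + 1))) + 2 * Real.exp (5 + 2 * ε₀) * ε₀ / q

end LDPLinUCB

/-! ### The theorem -/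

open LDPLinUCB in
theorem mainTheorem2 (ε₀ p : ℝ) (hp : p < 1) :
    ∃ (C : ℝ) (k : ℕ), ∀ P : LDPLinUCB.Params,
      0 < P.ε → P.ε ≤ ε₀ → 0 < P.δ → P.δ ≤ p → 0 < P.α → P.α ≤ p → 1 ≤ P.κ →
      ∀ (Ω : Type*) (mΩ : MeasurableSpace Ω) (μ : Measure Ω) (_ : IsProbabilityMeasure μ)
        (𝓕 : Filtration ℕ mΩ) (θ : LDPLinUCB.Vec P) (D : ℕ → Ω → Set (LDPLinUCB.Vec P))
        (x xs : ℕ → Ω → LDPLinUCB.Vec P) (η : ℕ → Ω → ℝ)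
        (z : ℕ → Ω → LDPLinUCB.NoiseIdx P → ℝ),
        LDPLinUCB.IsRun P μ 𝓕 θ D x xs η z →
          μ {ω | ¬ (LDPLinUCB.regret P θ (fun t => x t ω) (fun t => xs t ω) ≤
              C * P.κ * (1 + Real.log P.T) ^ k *
                (√(Real.log (1 / P.δ) * Real.log (1 / P.α)) *
                  ((P.d * P.T : ℝ) ^ (3 / 4 : ℝ) / P.ε)))}
            ≤ ENNReal.ofReal P.α := by
  -- Two of the three logarithmic factors come from the radius, one from the elliptical potential.
  refine ⟨regretConst ε₀ (Real.log (1 / p)), 3, ?_⟩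
  intro P hε hεε hδ hδp hα hαp hκ Ω mΩ μ _ 𝓕 θ D x xs η z hrun
  have hp0 : 0 < p := hδ.trans_le hδp
  have hε₀ : 0 < ε₀ := hε.trans_le hεε
  set q := Real.log (1 / p) with hqdef
  have hq : 0 < q := Real.log_pos ((one_lt_div hp0).2 hp)
  have hqδ : q ≤ Real.log (1 / P.δ) := Real.log_le_log (by positivity) (by gcongr)
  have hqα : q ≤ Real.log (1 / P.α) := Real.log_le_log (by positivity) (by gcongr)
  have hσε := one_le_sigma_mul hε hεε hδ (hδp.trans hp.le)
  have hσ : 0 < sigma P := pos_of_mul_pos_left (zero_lt_one.trans_le hσε) hε₀.le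
  set a := Real.log (1 / P.δ) with ha
  set b := Real.log (1 / P.α) with hb
  have ha0 : 0 < a := hq.trans_le hqδ
  have hb0 : 0 < b := hq.trans_le hqα
  have hlog : 0 ≤ Real.log P.T := Real.log_natCast_nonneg _
  have hℓ1 : 1 ≤ 1 + Real.log P.T := by linarith
  have hbc : 0 ≤ betaConst ε₀ q := by rw [betaConst]; positivity
  have hsab : q ≤ √(a * b) := Real.le_sqrt_of_sq_le (by rw [sq]; gcongr)
  -- Crude bound, enough when the horizon is short or the dimension large.
  have htriv : ∀ ω, regret P θ (fun t => x t ω) (fun t => xs t ω) ≤ 2 * P.T := by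
    intro ω
    rw [regret]
    refine (Finset.sum_le_card_nsmul _ _ 2 fun t ht => ?_).trans (by simp [mul_comm])
    have htT := Finset.mem_range.1 ht
    exact inner_sub_inner_le_two hrun.norm_param
      (hrun.norm_action t htT ω _ (hrun.action_mem t htT ω))
      (hrun.norm_action t htT ω _ (hrun.best_mem t htT ω))
  -- The factor ε₀/q in the second summand of `regretConst` compensates √(ab)/ε ≥ q/ε₀.
  have hsmall : ∀ m : ℝ, 0 ≤ m → 2 * m ≤ 2 * Real.exp (5 + 2 * ε₀) * (P.d * P.T : ℝ) ^ (3 / 4 : ℝ) →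
      2 * m ≤ regretConst ε₀ q * P.κ * (1 + Real.log P.T) ^ 3 *
                (√(a * b) * ((P.d * P.T : ℝ) ^ (3 / 4 : ℝ) / P.ε)) := by
    intro m hm hle
    have h1 : 2 * Real.exp (5 + 2 * ε₀) * ε₀ / q ≤ regretConst ε₀ q := by
      rw [regretConst]
      exact le_add_of_nonneg_left (by positivity)
    have h2 : 1 ≤ P.κ * (1 + Real.log P.T) ^ 3 :=
      one_le_mul_of_one_le_of_one_le hκ (one_le_pow₀ hℓ1)
    calc 2 * m ≤ 2 * Real.exp (5 + 2 * ε₀) * (P.d * P.T : ℝ) ^ (3 / 4 : ℝ) := hle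
      _ = (2 * Real.exp (5 + 2 * ε₀) * ε₀ / q) * 1 * (q * ((P.d * P.T : ℝ) ^ (3 / 4 : ℝ) / ε₀)) := by
          field_simp
      _ ≤ regretConst ε₀ q * (P.κ * (1 + Real.log P.T) ^ 3) *
          (√(a * b) * ((P.d * P.T : ℝ) ^ (3 / 4 : ℝ) / P.ε)) := by
          have h3 : 0 ≤ regretConst ε₀ q := h1.trans' (by positivity)
          gcongr
      _ = _ := by ring
  have hsure : (∀ ω, regret P θ (fun t => x t ω) (fun t => xs t ω) ≤
      regretConst ε₀ q * P.κ * (1 + Real.log P.T) ^ 3 *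
        (√(a * b) * ((P.d * P.T : ℝ) ^ (3 / 4 : ℝ) / P.ε))) →
      μ {ω | ¬ (regret P θ (fun t => x t ω) (fun t => xs t ω) ≤
        regretConst ε₀ q * P.κ * (1 + Real.log P.T) ^ 3 *
        (√(a * b) * ((P.d * P.T : ℝ) ^ (3 / 4 : ℝ) / P.ε)))} ≤ ENNReal.ofReal P.α := by
    intro h
    simp only [h, not_true_eq_false, Set.ofPred_false, measure_empty, zero_le]
  have hexp1 : 1 ≤ Real.exp (5 + 2 * ε₀) := Real.one_le_exp (by positivity)
  rcases Nat.eq_zero_or_pos P.d with hd0 | hd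
  · have : IsEmpty (Fin P.d) := by rw [hd0]; infer_instance
    refine hsure fun ω => ?_
    have h0 : regret P θ (fun t => x t ω) (fun t => xs t ω) = 2 * 0 := by
      simp [regret, inner_eq_dotProduct, dotProduct]
    rw [h0]
    exact hsmall 0 le_rfl (by rw [mul_zero]; positivity)
  rcases Nat.eq_zero_or_pos P.T with hT0 | hTpos
  · refine hsure fun ω => (htriv ω).trans (hsmall _ (by positivity) ?_)
    simp only [hT0, Nat.cast_zero, mul_zero]
    positivity
  have hd1 : (1 : ℝ) ≤ P.d := by exact_mod_cast hd
  have hT1 : (1 : ℝ) ≤ P.T := by exact_mod_cast hTpos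
  have hdT1 : (1 : ℝ) ≤ P.d * P.T := one_le_mul_of_one_le_of_one_le hd1 hT1
  rcases le_total P.T P.d with hTd | hdT
  · refine hsure fun ω => (htriv ω).trans (hsmall _ (by positivity) ?_)
    have h1 : (P.T : ℝ) ≤ (P.d * P.T : ℝ) ^ (3 / 4 : ℝ) := by
      have h2 : (P.T : ℝ) ≤ P.d := by exact_mod_cast hTd
      calc (P.T : ℝ) = ((P.T : ℝ) * P.T) ^ (1 / 2 : ℝ) := by
            rw [← Real.sqrt_eq_rpow, Real.sqrt_mul_self (by positivity)]
        _ ≤ (P.d * P.T : ℝ) ^ (1 / 2 : ℝ) := by gcongr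
        _ ≤ _ := Real.rpow_le_rpow_of_exponent_le hdT1 (by norm_num)
    calc 2 * (P.T : ℝ) ≤ 2 * 1 * (P.d * P.T : ℝ) ^ (3 / 4 : ℝ) := by linarith
      _ ≤ _ := by gcongr
  rcases le_total (Real.log P.T) (5 + 2 * ε₀) with hTs | hTl
  · refine hsure fun ω => (htriv ω).trans (hsmall _ (by positivity) ?_)
    rw [Real.log_le_iff_le_exp (by positivity)] at hTs
    have := Real.one_le_rpow hdT1 (show (0 : ℝ) ≤ 3 / 4 by norm_num)
    calc 2 * (P.T : ℝ) ≤ 2 * Real.exp (5 + 2 * ε₀) * 1 := by linarith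
      _ ≤ _ := by gcongr
  -- Long horizon: the noise is controlled with high probability.
  obtain ⟨s, hcard, hs⟩ := exists_sphere_net P.d
  have hα1 : P.α ≤ 1 := hαp.trans hp.le
  have hL : Real.log P.T ≤ Real.log (2 * P.T / P.α) := by
    refine Real.log_le_log (by positivity) ?_
    rw [le_div_iff₀ hα]
    nlinarith
  -- Since 5 ≤ e², the 2d pays for the 5^d net points; the logarithm pays for the T times and four
  -- tails, leaving α.
  set r := 2 * (P.d : ℝ) + Real.log (4 * P.T / P.α) with hr
  have hlog4 : Real.log (4 * P.T / P.α) = Real.log 2 + Real.log (2 * P.T / P.α) := by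
    rw [← Real.log_mul two_ne_zero (by positivity)]
    congr 1
    ring
  have hlog2 : Real.log 2 ≤ 1 := by linarith [Real.log_two_lt_d9]
  have hlog20 : 0 ≤ Real.log 2 := Real.log_nonneg one_le_two
  have hr0 : 0 ≤ r := by rw [hr, hlog4]; linarith
  obtain ⟨bad, hbad, hgood⟩ := hrun.exists_bad_event hσ hs hcard hr0
  refine (measure_mono fun ω hω => ?_).trans (hbad.trans (ENNReal.ofReal_le_ofReal ?_))
  · by_contra hnb
    refine hω ?_
    set y := (P.d * P.T : ℝ) ^ (1 / 4 : ℝ) with hy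
    have hy1 : 1 ≤ y := Real.one_le_rpow hdT1 (by norm_num)
    have hy4 : y ^ 4 = P.d * P.T := by
      rw [hy, ← Real.rpow_natCast, ← Real.rpow_mul (by positivity)]
      norm_num
    have hy3 : (P.d * P.T : ℝ) ^ (3 / 4 : ℝ) = y ^ 3 := by
      rw [hy, ← Real.rpow_natCast, ← Real.rpow_mul (by positivity)]
      norm_num
    set B := sigma P * y * P.κ * (1 + Real.log P.T) ^ 2 * √b * betaConst ε₀ q with hB
    have hB1 : 1 ≤ B := one_le_betaBound hq hε₀ hσ hσε hκ hqα hy1 hℓ1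
    have h1 := regret_le_of_noise hσ hε₀.le hσε hκ hTl (by linarith)
      (by rw [hr, hlog4]; linarith) hB1
      (fun t ht1 htT => beta_le hq hε₀ hσ hσε hκ hα hqα hd hdT hy1 hy4 ht1 htT) hrun.norm_param
      (D := fun t => D t ω) (fun t ht => hrun.norm_action t ht ω)
      (fun t ht => hrun.action_mem t ht ω) (fun t ht => hrun.best_mem t ht ω)
      (fun t ht => hrun.action_max t ht ω) hs (hgood ω hnb)
    have h2 := two_mul_bound_le hε₀ hσ hσε (zero_le_one.trans hB1) hTl hT1 (by linarith) hy1 hy4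
    refine (h1.trans h2).trans ?_
    have h3 := sigma_le hq hε hδ hqδ
    rw [hy3, Real.sqrt_mul ha0.le]
    calc 6 * B * y ^ 2 * (1 + Real.log P.T)
        = (6 * betaConst ε₀ q * P.κ * (1 + Real.log P.T) ^ 3 * √b * y ^ 3) * sigma P := by
          rw [hB]; ring
      _ ≤ (6 * betaConst ε₀ q * P.κ * (1 + Real.log P.T) ^ 3 * √b * y ^ 3)
          * (6 * √(2 * (1 / q + 1)) * (√a / P.ε)) := by gcongr
      _ = (6 * betaConst ε₀ q * (6 * √(2 * (1 / q + 1)))) * P.κ * (1 + Real.log P.T) ^ 3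
          * (√a * √b * (y ^ 3 / P.ε)) := by ring
      _ ≤ _ := by
          gcongr
          rw [regretConst]
          exact le_add_of_nonneg_right (by positivity)
  · have h5 : (5 : ℝ) ≤ Real.exp 2 := by
      have := Real.exp_one_gt_d9
      rw [show (2 : ℝ) = 1 + 1 by norm_num, Real.exp_add]
      nlinarith
    have h6 : Real.exp (-r) = (Real.exp 2 ^ P.d)⁻¹ * (P.α / (4 * P.T)) := by
      rw [hr, neg_add, Real.exp_add, ← Real.log_inv, Real.exp_log (by positivity), inv_div,
        ← Real.exp_nat_mul, Real.exp_neg]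
      ring_nf
    rw [h6]
    calc 4 * (P.T : ℝ) * 5 ^ P.d * ((Real.exp 2 ^ P.d)⁻¹ * (P.α / (4 * P.T)))
        ≤ 4 * (P.T : ℝ) * Real.exp 2 ^ P.d * ((Real.exp 2 ^ P.d)⁻¹ * (P.α / (4 * P.T))) := by
          gcongr
      _ = P.α := by field_simp
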